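/- Let $(\mathcal G,\mu)$ be a discrete p.m.p. groupoid with unit space $X$, range map $r$ and source map $s$: $\mathcal G$ is a standard Borel groupoid whose structure maps are Borel, $r$ and $s$ are countable-to-one, and $\mu$ is a Borel probability measure on $X$ with $\int_X c^r_x\,d\mu(x)=\int_X c^s_x\,d\mu(x)$, where $c^r_x$ and $c^s_x$ are the counting measures on $\mathcal G^x=r^{-1}(x)$ and $\mathcal G_x=s^{-1}(x)$. Its full group $[\mathcal G]$ consists of the Borel maps $T\colon X\to\mathcal G$ with $Tx\in\mathcal G_x$ for all $x$ and $T^\circ=r\circ T$ injective, two of them being identified if they agree almost everywhere, with product $(S\circ T)x=S(T^\circ x)\,Tx$. A sequence $(T_n)$ in $[\mathcal G]$ is central if $\mu(\{x\in X\mid (T_n\circ S)x\neq (S\circ T_n)x\})\to 0$ for every $S\in[\mathcal G]$. Let $\mathcal S$ be a Borel subgroupoid of $\mathcal G$ with unit space $X$, let $(Y,\nu)$ be a standard probability space, and let $\alpha\colon\mathcal S\to\mathrm{Aut}(Y,\nu)$ be a Borel homomorphism into the group of measure-preserving Borel automorphisms of $(Y,\nu)$ (identified if they agree almost everywhere), given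 by a family of representatives such that $(h,y)\mapsto\alpha(h)y$ is Borel. For $x\in X$ put $$Z_x=\{f\colon\mathcal G^x\to Y\mid f(gh^{-1})=\alpha(h)f(g)\ \text{for all } g\in\mathcal G^x,\ h\in\mathcal S \text{ with } s(h)=s(g)\},\qquad Z=\bigsqcup_{x\in X}Z_x ,$$ on which $\mathcal G$ acts by $(gf)(g')=f(g^{-1}g')$ for $f\in Z_{s(g)}$, $g'\in\mathcal G^{r(g)}$. Call $g,h\in\mathcal G^x$ equivalent if $g^{-1}h\in\mathcal S$, and for $m\in\mathbb N\cup\{\infty\}$ let $X_m$ be the set of $x$ for which $\mathcal G^x$ has exactly $m$ equivalence classes. A family of choice functions is a family of Borel maps $\psi_i$ with $\psi_i(x)\in\mathcal G^x$ such that, for every $m$ and $x\in X_m$, the elements $\psi_i(x)$ with $1\le i\le m$ ($i\in\mathbb N$) form a complete set of representatives of the equivalence classes in $\mathcal G^x$. Such a family induces a Borel structure and a probability measure $\zeta$ on $Z$ through the identification (up to null sets) of the part of $Z$ over $X_m$ with $X_m\times\prod_{i=1}^mY$, carrying the measure $\mu|_{X_m}\times\prod_{i=1}^m\nu$, by $f\in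 Z_x\mapsto(x,(f(\psi_i(x)))_i)$. The groupoid $(\mathcal G,\mu)\ltimes(Z,\zeta)$ of this co-induced action has unit space $(Z,\zeta)$ and arrows $(g,z)$ with $z\in Z_{s(g)}$, source $z$, range $gz$, product $(g,hz)(h,z)=(gh,z)$ and inverse $(g,z)^{-1}=(g^{-1},gz)$. The lift of $T\in[\mathcal G]$ is the element $\tilde T$ of its full group given by $\tilde Tz=(Tx,z)$ for $z\in Z_x$. Let $(T_n)$ be a central sequence in $[\mathcal G]$ such that each $T_n$ belongs to $[\mathcal S]$ and, for each Borel subset $B\subset Y$, $$\int_X\nu\bigl(\alpha(T_nx)B\bigtriangleup B\bigr)\,d\mu(x)\to 0 .$$ Then a family of choice functions exists and, for every such family, the sequence $(\tilde T_n)$ of lifts is central in the full group of $(\mathcal G,\mu)\ltimes(Z,\zeta)$. -/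

import Mathlib

open MeasureTheory Set Filter Topology
open scoped ENNReal

/-- A groupoid with unit space `X` and set of arrows `G`. An arrow `g` goes from its source `s g` to
its range `r g`, and `mul g h` is defined exactly when `s g = r h`. -/
structure SetGroupoid (X G : Type*) where
  r : G → X
  s : G → X
  unit : X → G
  mul : (g h : G) → s g = r h → G
  inv : G → G
  r_unit : ∀ x, r (unit x) = x
  s_unit : ∀ x, s (unit x) = x
  r_mul : ∀ g h hc, r (mul g h hc) = r g
  s_mul : ∀ g h hc, s (mul g h hc) = s h
  r_inv : ∀ g, r (inv g) = s g
  s_inv : ∀ g, s (inv g) = r g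
  mul_assoc : ∀ (g h k : G) (hgh : s g = r h) (hhk : s h = r k),
    mul (mul g h hgh) k ((s_mul g h hgh).trans hhk) =
      mul g (mul h k hhk) (hgh.trans (r_mul h k hhk).symm)
  unit_mul : ∀ g, mul (unit (r g)) g (s_unit (r g)) = g
  mul_unit : ∀ g, mul g (unit (s g)) (r_unit (s g)).symm = g
  inv_mul : ∀ g, mul (inv g) g (s_inv g) = unit (s g)
  mul_inv : ∀ g, mul g (inv g) (r_inv g).symm = unit (r g)

/-- A discrete p.m.p. groupoid: a discrete Borel groupoid (standard Borel, Borel structure maps,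
countable-to-one range and source maps) with a Borel probability measure `μ` on the unit space such
that `∫ c^r_x dμ(x) = ∫ c^s_x dμ(x)`, where `c^r_x` and `c^s_x` are the counting measures on
`r⁻¹(x)` and `s⁻¹(x)`. -/
structure SetGroupoid.IsDiscretePMP {X G : Type*} [MeasurableSpace X] [MeasurableSpace G]
    (𝒢 : SetGroupoid X G) (μ : Measure X) : Prop where
  standardBorel_units : StandardBorelSpace X
  standardBorel_arrows : StandardBorelSpace G
  measurable_r : Measurable 𝒢.r
  measurable_s : Measurable 𝒢.s
  measurable_unit : Measurable 𝒢.unit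
  measurable_mul : Measurable fun p : {p : G × G // 𝒢.s p.1 = 𝒢.r p.2} =>
    𝒢.mul p.1.1 p.1.2 p.2
  measurable_inv : Measurable 𝒢.inv
  countable_r : ∀ x, {g | 𝒢.r g = x}.Countable
  countable_s : ∀ x, {g | 𝒢.s g = x}.Countable
  isProbabilityMeasure : IsProbabilityMeasure μ
  measure_eq : ∀ A : Set G, MeasurableSet A →
    ∫⁻ x, Measure.count (A ∩ {g | 𝒢.r g = x}) ∂μ = ∫⁻ x, Measure.count (A ∩ {g | 𝒢.s g = x}) ∂μ

/-- An element of the full group, given by a representative: a Borel map `T` with `T x` an arrow of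
source `x` for every unit `x`, such that `x ↦ r (T x)` is injective. Two representatives give the
same element of the full group when they agree almost everywhere; the notions below that refer to a
measure depend only on the classes. -/
structure FullGroup {X G : Type*} [MeasurableSpace X] [MeasurableSpace G]
    (𝒢 : SetGroupoid X G) where
  toFun : X → G
  measurable : Measurable toFun
  source : ∀ x, 𝒢.s (toFun x) = x
  injective : Function.Injective fun x => 𝒢.r (toFun x)

/-- The composition `(S ∘ T) x = S (T° x) · T x` of elements of the full group, where
`T° x = r (T x)`. -/
def FullGroup.comp {X G : Type*} [MeasurableSpace X] [MeasurableSpace G] {𝒢 : SetGroupoid X G}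
    (S T : FullGroup 𝒢) (x : X) : G :=
  𝒢.mul (S.toFun (𝒢.r (T.toFun x))) (T.toFun x) (S.source _)

/-- A sequence in the full group is central if it asymptotically commutes with every element. -/
def IsCentralSeq {X G : Type*} [MeasurableSpace X] [MeasurableSpace G] {𝒢 : SetGroupoid X G}
    (μ : Measure X) (T : ℕ → FullGroup 𝒢) : Prop :=
  ∀ S : FullGroup 𝒢,
    Tendsto (fun n => μ {x | (T n).comp S x ≠ S.comp (T n) x}) atTop (𝓝 0)

/-- A Borel subgroupoid (with the same unit space). -/
structure BorelSubgroupoid {X G : Type*} [MeasurableSpace G] (𝒢 : SetGroupoid X G) where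
  carrier : Set G
  measurableSet : MeasurableSet carrier
  unit_mem : ∀ x, 𝒢.unit x ∈ carrier
  mul_mem : ∀ g h hc, g ∈ carrier → h ∈ carrier → 𝒢.mul g h hc ∈ carrier
  inv_mem : ∀ g, g ∈ carrier → 𝒢.inv g ∈ carrier

/-- A Borel homomorphism `α` from `𝒮` to `Aut(Y, ν)`, the group of measure-preserving Borel
automorphisms of `(Y, ν)` in which automorphisms that agree almost everywhere are identified. It is
given by a jointly Borel family of representatives, and multiplicativity is equality in `Aut(Y, ν)`,
that is, almost everywhere. -/
structure AutHom {X G : Type*} [MeasurableSpace G] {𝒢 : SetGroupoid X G}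
    (𝒮 : BorelSubgroupoid 𝒢) {Y : Type*} [MeasurableSpace Y] (ν : Measure Y) where
  toFun : 𝒮.carrier → Y ≃ᵐ Y
  measurable : Measurable fun p : 𝒮.carrier × Y => toFun p.1 p.2
  measurePreserving : ∀ h, MeasurePreserving (toFun h) ν ν
  map_mul : ∀ (g h : 𝒮.carrier) (hc : 𝒢.s g = 𝒢.r h),
    ∀ᵐ y ∂ν, toFun ⟨𝒢.mul g h hc, 𝒮.mul_mem g h hc g.2 h.2⟩ y = toFun g (toFun h y)

section groupoidLemmas

variable {X G : Type*} (𝒢 : SetGroupoid X G)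

theorem SetGroupoid.mul_congr {g g' h h' : G} (hg : g = g') (hh : h = h')
    (hc : 𝒢.s g = 𝒢.r h) (hc' : 𝒢.s g' = 𝒢.r h') : 𝒢.mul g h hc = 𝒢.mul g' h' hc' := by
  subst hg; subst hh; rfl

theorem SetGroupoid.inv_mul_cancel_left (g h : G) (hc : 𝒢.s g = 𝒢.r h) :
    𝒢.mul (𝒢.inv g) (𝒢.mul g h hc) ((𝒢.s_inv g).trans (𝒢.r_mul g h hc).symm) = h := by
  rw [← 𝒢.mul_assoc (𝒢.inv g) g h (𝒢.s_inv g) hc]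
  exact (𝒢.mul_congr ((𝒢.inv_mul g).trans (congrArg 𝒢.unit hc)) rfl _ (𝒢.s_unit _)).trans
    (𝒢.unit_mul h)

theorem SetGroupoid.mul_inv_cancel_left (g h : G) (hc : 𝒢.r g = 𝒢.r h) :
    𝒢.mul g (𝒢.mul (𝒢.inv g) h ((𝒢.s_inv g).trans hc))
      ((𝒢.r_inv g).symm.trans (𝒢.r_mul _ _ _).symm) = h := by
  rw [← 𝒢.mul_assoc g (𝒢.inv g) h (𝒢.r_inv g).symm ((𝒢.s_inv g).trans hc)]
  exact (𝒢.mul_congr ((𝒢.mul_inv g).trans (congrArg 𝒢.unit hc)) rfl _ (𝒢.s_unit _)).trans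
    (𝒢.unit_mul h)

theorem SetGroupoid.mul_left_cancel (g h k : G) (hc : 𝒢.s g = 𝒢.r h) (hc' : 𝒢.s g = 𝒢.r k)
    (e : 𝒢.mul g h hc = 𝒢.mul g k hc') : h = k := by
  rw [← 𝒢.inv_mul_cancel_left g h hc, ← 𝒢.inv_mul_cancel_left g k hc']
  exact 𝒢.mul_congr rfl e _ _

theorem SetGroupoid.eq_inv (g h : G) (hc : 𝒢.s g = 𝒢.r h)
    (e : 𝒢.mul g h hc = 𝒢.unit (𝒢.r g)) : h = 𝒢.inv g :=
  𝒢.mul_left_cancel g h (𝒢.inv g) hc (𝒢.r_inv g).symm (e.trans (𝒢.mul_inv g).symm)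

theorem SetGroupoid.inv_inv (g : G) : 𝒢.inv (𝒢.inv g) = g :=
  (𝒢.eq_inv (𝒢.inv g) g (𝒢.s_inv g)
    ((𝒢.inv_mul g).trans (congrArg 𝒢.unit (𝒢.r_inv g).symm))).symm

theorem SetGroupoid.inv_unit (x : X) : 𝒢.inv (𝒢.unit x) = 𝒢.unit x :=
  (𝒢.eq_inv (𝒢.unit x) (𝒢.unit x) ((𝒢.s_unit x).trans (𝒢.r_unit x).symm)
    ((𝒢.mul_congr (congrArg 𝒢.unit (𝒢.r_unit x).symm) rfl _ (𝒢.s_unit _)).trans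
      ((𝒢.unit_mul _).trans (congrArg 𝒢.unit (𝒢.r_unit x).symm)))).symm

theorem SetGroupoid.inv_mul_rev (g h : G) (hc : 𝒢.s g = 𝒢.r h) :
    𝒢.inv (𝒢.mul g h hc) =
      𝒢.mul (𝒢.inv h) (𝒢.inv g) ((𝒢.s_inv h).trans (hc.symm.trans (𝒢.r_inv g).symm)) := by
  symm
  refine 𝒢.eq_inv _ _ ((𝒢.s_mul _ _ _).trans ((𝒢.r_inv h).symm.trans (𝒢.r_mul _ _ _).symm)) ?_
  rw [𝒢.mul_assoc g h _ hc ((𝒢.r_inv h).symm.trans (𝒢.r_mul _ _ _).symm)]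
  refine (𝒢.mul_congr rfl (𝒢.mul_inv_cancel_left h (𝒢.inv g) (hc.symm.trans (𝒢.r_inv g).symm))
    _ (𝒢.r_inv g).symm).trans ?_
  rw [𝒢.mul_inv, 𝒢.r_mul]

end groupoidLemmas

section coinduction

variable {X G : Type*} [MeasurableSpace X] [MeasurableSpace G] {𝒢 : SetGroupoid X G}

/-- The equivalence relation on `𝒢^x = r⁻¹(x)` associated with `𝒮`: `g ∼ h` iff `g⁻¹ h ∈ 𝒮`. -/
def BorelSubgroupoid.cosetSetoid (𝒮 : BorelSubgroupoid 𝒢) (x : X) : Setoid {g // 𝒢.r g = x} where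
  r g h := 𝒢.mul (𝒢.inv g) h ((𝒢.s_inv _).trans (g.2.trans h.2.symm)) ∈ 𝒮.carrier
  iseqv :=
    { refl := fun g => by
        rw [𝒢.inv_mul]; exact 𝒮.unit_mem _
      symm := fun {g h} hgh => by
        have := 𝒮.inv_mem _ hgh
        rw [𝒢.inv_mul_rev] at this
        rwa [𝒢.mul_congr rfl (𝒢.inv_inv g) _ ((𝒢.s_inv _).trans (h.2.trans g.2.symm))] at this
      trans := fun {g h k} hgh hhk => by
        have := 𝒮.mul_mem _ _ ((𝒢.s_mul _ _ _).trans ((𝒢.r_inv _).symm.trans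
          (𝒢.r_mul _ _ _).symm)) hgh hhk
        rw [𝒢.mul_assoc _ _ _ ((𝒢.s_inv _).trans (g.2.trans h.2.symm))
          ((𝒢.r_inv _).symm.trans (𝒢.r_mul _ _ _).symm)] at this
        rwa [𝒢.mul_congr rfl (𝒢.mul_inv_cancel_left _ _ (h.2.trans k.2.symm)) _
          ((𝒢.s_inv _).trans (g.2.trans k.2.symm))] at this }

/-- The index of `𝒮` in `𝒢` at `x`: the number of equivalence classes in `𝒢^x`. The set `X_m` of the
decomposition `X = ⨆ X_m` is `{x | 𝒮.index x = m}`. -/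
noncomputable def BorelSubgroupoid.index (𝒮 : BorelSubgroupoid 𝒢) (x : X) : ℕ∞ :=
  ENat.card (Quotient (𝒮.cosetSetoid x))

/-- A family of choice functions for `𝒮 < 𝒢`: Borel maps `ψ i` with `ψ i x ∈ 𝒢^x` such that, for
every `x`, the `ψ i x` with `i` less than the index at `x` form a complete set of representatives of
the equivalence classes in `𝒢^x` (indices start at `0`; the `ψ i x` with `i` at least the index are
never used). -/
structure ChoiceFunctions (𝒮 : BorelSubgroupoid 𝒢) where
  ψ : ℕ → X → G
  measurable : ∀ i, Measurable (ψ i)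
  range_eq : ∀ i x, 𝒢.r (ψ i x) = x
  complete : ∀ (x : X) (g : {g // 𝒢.r g = x}),
    ∃! i : ℕ, (i : ℕ∞) < 𝒮.index x ∧ 𝒮.cosetSetoid x g ⟨ψ i x, range_eq i x⟩

variable {𝒮 : BorelSubgroupoid 𝒢} {Y : Type*} [MeasurableSpace Y] {ν : Measure Y}

/-- The space `Z = ⨆_x Z_x` on which the co-induced action lives: a point of `Z_x` is a map
`f : 𝒢^x → Y` with `f (g h⁻¹) = α(h) f(g)` for `g ∈ 𝒢^x` and `h ∈ 𝒮` with `s h = s g`. The set does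
not depend on the family of choice functions, which is carried along for the measure-space structure
(see below). -/
structure CoindSpace (α : AutHom 𝒮 ν) (ψ : ChoiceFunctions 𝒮) where
  base : X
  toFun : {g // 𝒢.r g = base} → Y
  equivariant : ∀ (g : {g // 𝒢.r g = base}) (h : 𝒮.carrier) (hc : 𝒢.s h = 𝒢.s g),
    toFun ⟨𝒢.mul g (𝒢.inv h) (hc.symm.trans (𝒢.r_inv h).symm), (𝒢.r_mul _ _ _).trans g.2⟩ =
      α.toFun h (toFun g)

variable {α : AutHom 𝒮 ν} {ψ : ChoiceFunctions 𝒮}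

/-- The product spaces `X × ∏_{i < m} Y`, put together for all `m ∈ ℕ ∪ {∞}`. -/
abbrev CoindCode (X Y : Type*) : Type _ := Σ m : ℕ∞, X × ({i : ℕ // (i : ℕ∞) < m} → Y)

/-- The identification of the part of `Z` over `X_m` with `X_m × ∏_{i < m} Y`, sending `f ∈ Z_x` to
`(x, (f (ψ_i x))_i)`. It is injective, and its range is all of `⨆_m X_m × ∏_{i < m} Y` up to a null
set (without exception if `α` is multiplicative at every point of `Y`). -/
noncomputable def CoindSpace.code (z : CoindSpace α ψ) : CoindCode X Y :=
  ⟨𝒮.index z.base, z.base, fun i => z.toFun ⟨ψ.ψ i z.base, ψ.range_eq i z.base⟩⟩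

/-- The Borel structure on `Z` induced by the identification with the product spaces. -/
noncomputable instance CoindSpace.instMeasurableSpace : MeasurableSpace (CoindSpace α ψ) :=
  MeasurableSpace.comap CoindSpace.code inferInstance

/-- The measure on the product spaces: on `X × ∏_{i < m} Y` it is the restriction of `μ` to `X_m`
times the product of copies of `ν`. -/
noncomputable def coindCodeMeasure (𝒮 : BorelSubgroupoid 𝒢) (μ : Measure X) (ν : Measure Y)
    [IsProbabilityMeasure ν] : Measure (CoindCode X Y) :=
  Measure.sum fun m : ℕ∞ =>
    ((μ.restrict {x | 𝒮.index x = m}).prod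
      (Measure.infinitePi fun _ : {i : ℕ // (i : ℕ∞) < m} => ν)).map (Sigma.mk m)

/-- The measure `ζ` on `Z` induced by the identification with the product spaces. -/
noncomputable def coindMeasure [IsProbabilityMeasure ν] (μ : Measure X) (α : AutHom 𝒮 ν)
    (ψ : ChoiceFunctions 𝒮) : Measure (CoindSpace α ψ) :=
  (coindCodeMeasure 𝒮 μ ν).comap CoindSpace.code

theorem CoindSpace.ext' {z w : CoindSpace α ψ} (hb : z.base = w.base)
    (hf : ∀ (g : G) (h₁ : 𝒢.r g = z.base) (h₂ : 𝒢.r g = w.base),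
      z.toFun ⟨g, h₁⟩ = w.toFun ⟨g, h₂⟩) : z = w := by
  obtain ⟨b, f, hz⟩ := z
  obtain ⟨c, f', hw⟩ := w
  obtain rfl : b = c := hb
  obtain rfl : f = f' := funext fun g => hf g.1 g.2 g.2
  rfl

theorem CoindSpace.toFun_congr (z : CoindSpace α ψ) {g h : G} (e : g = h) (hg : 𝒢.r g = z.base)
    (hh : 𝒢.r h = z.base) : z.toFun ⟨g, hg⟩ = z.toFun ⟨h, hh⟩ := by
  subst e; rfl

/-- The co-induced action of `𝒢` on `Z`: `(g f)(g') = f (g⁻¹ g')` for `f ∈ Z_{s g}` and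
`g' ∈ 𝒢^{r g}`. -/
def CoindSpace.act (g : G) (z : CoindSpace α ψ) (hz : 𝒢.s g = z.base) : CoindSpace α ψ where
  base := 𝒢.r g
  toFun g' := z.toFun ⟨𝒢.mul (𝒢.inv g) g' ((𝒢.s_inv g).trans g'.2.symm),
    (𝒢.r_mul _ _ _).trans ((𝒢.r_inv g).trans hz)⟩
  equivariant g' h hc := by
    rw [← z.equivariant _ h (hc.trans (𝒢.s_mul _ _ _).symm)]
    exact z.toFun_congr (𝒢.mul_assoc _ _ _ _ _).symm _ _

theorem CoindSpace.act_unit (x : X) (z : CoindSpace α ψ) (hz : 𝒢.s (𝒢.unit x) = z.base) :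
    z.act (𝒢.unit x) hz = z := by
  refine CoindSpace.ext' ((𝒢.r_unit x).trans ((𝒢.s_unit x).symm.trans hz)) ?_
  intro g h₁ h₂
  refine z.toFun_congr ?_ _ _
  refine (𝒢.mul_congr ((𝒢.inv_unit x).trans (congrArg 𝒢.unit ?_)) rfl _ (𝒢.s_unit _)).trans
    (𝒢.unit_mul g)
  exact (𝒢.s_unit x).symm.trans (hz.trans h₂.symm)

theorem CoindSpace.act_mul (g h : G) (hc : 𝒢.s g = 𝒢.r h) (z : CoindSpace α ψ)
    (hz : 𝒢.s h = z.base) :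
    z.act (𝒢.mul g h hc) ((𝒢.s_mul _ _ _).trans hz) = (z.act h hz).act g hc := by
  refine CoindSpace.ext' (𝒢.r_mul g h hc) ?_
  intro k h₁ h₂
  refine z.toFun_congr ?_ _ _
  refine (𝒢.mul_congr (𝒢.inv_mul_rev g h hc) rfl _
    ((𝒢.s_mul _ _ _).trans ((𝒢.s_inv g).trans h₂.symm))).trans ?_
  exact 𝒢.mul_assoc _ _ _ _ _

theorem CoindSpace.act_congr {g h : G} {z w : CoindSpace α ψ} (e : g = h) (e' : z = w)
    (hz : 𝒢.s g = z.base) (hw : 𝒢.s h = w.base) : z.act g hz = w.act h hw := by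
  subst e; subst e'; rfl

theorem CoindSpace.act_inv_act (g : G) (z : CoindSpace α ψ) (hz : 𝒢.s g = z.base) :
    (z.act g hz).act (𝒢.inv g) (𝒢.s_inv g) = z := by
  rw [← CoindSpace.act_mul (𝒢.inv g) g (𝒢.s_inv g) z hz]
  exact (CoindSpace.act_congr (𝒢.inv_mul g) rfl _ ((𝒢.s_unit _).trans hz)).trans
    (z.act_unit _ _)

/-- The groupoid `𝒢 ⋉ Z` of the co-induced action: its unit space is `Z`, its arrows are the pairs
`(g, z)` with `s g` the base point of `z`, and `r (g, z) = g z`, `s (g, z) = z`,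
`(g, h z) (h, z) = (g h, z)`, `(g, z)⁻¹ = (g⁻¹, g z)`. Its Borel structure is that of a subspace of
the product. -/
def coindGroupoid (α : AutHom 𝒮 ν) (ψ : ChoiceFunctions 𝒮) :
    SetGroupoid (CoindSpace α ψ) {p : G × CoindSpace α ψ // 𝒢.s p.1 = p.2.base} where
  r p := p.1.2.act p.1.1 p.2
  s p := p.1.2
  unit z := ⟨(𝒢.unit z.base, z), 𝒢.s_unit _⟩
  mul p q hc := ⟨(𝒢.mul p.1.1 q.1.1 (p.2.trans (congrArg CoindSpace.base hc)), q.1.2),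
    (𝒢.s_mul _ _ _).trans q.2⟩
  inv p := ⟨(𝒢.inv p.1.1, p.1.2.act p.1.1 p.2), 𝒢.s_inv _⟩
  r_unit z := z.act_unit _ _
  s_unit _ := rfl
  r_mul p q hc := by
    refine (CoindSpace.act_mul _ _ _ q.1.2 q.2).trans ?_
    exact CoindSpace.act_congr rfl hc.symm _ _
  s_mul _ _ _ := rfl
  r_inv p := p.1.2.act_inv_act _ p.2
  s_inv _ := rfl
  mul_assoc p q t h₁ h₂ := Subtype.ext (Prod.ext (𝒢.mul_assoc _ _ _ _ _) rfl)
  unit_mul p := Subtype.ext (Prod.ext (𝒢.unit_mul _) rfl)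
  mul_unit p := Subtype.ext (Prod.ext
    ((𝒢.mul_congr rfl (congrArg 𝒢.unit p.2.symm) _ (𝒢.r_unit _).symm).trans (𝒢.mul_unit _)) rfl)
  inv_mul p := Subtype.ext (Prod.ext ((𝒢.inv_mul _).trans (congrArg 𝒢.unit p.2)) rfl)
  mul_inv p := Subtype.ext (Prod.ext (𝒢.mul_inv _) rfl)

theorem CoindSpace.measurable_base : Measurable (CoindSpace.base : CoindSpace α ψ → X) := by
  have h : Measurable fun c : CoindCode X Y => c.2.1 := by
    intro A hA
    rw [MeasurableSpace.measurableSet_iInf]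
    intro m
    exact measurable_fst hA
  exact h.comp (comap_measurable CoindSpace.code)

/-- The lift `T̃ z = (T x, z)`, for `z ∈ Z_x`, of an element `T` of the full group of `𝒢` to the full
group of the groupoid of the co-induced action. -/
def FullGroup.lift (T : FullGroup 𝒢) (α : AutHom 𝒮 ν) (ψ : ChoiceFunctions 𝒮) :
    FullGroup (coindGroupoid α ψ) where
  toFun z := ⟨(T.toFun z.base, z), T.source z.base⟩
  measurable :=
    ((T.measurable.comp CoindSpace.measurable_base).prodMk measurable_id).subtype_mk
  source _ := rfl
  injective z w e := by
    have e : z.act (T.toFun z.base) (T.source _) = w.act (T.toFun w.base) (T.source _) := e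
    have hb : z.base = w.base := T.injective (congrArg CoindSpace.base e)
    rw [← z.act_inv_act (T.toFun z.base) (T.source _),
      ← w.act_inv_act (T.toFun w.base) (T.source _)]
    exact CoindSpace.act_congr (by rw [hb]) e _ _

end coinduction

/-!
The proof rests on countable decompositions of the arrows. By the Lusin–Novikov theorem
(`exists_measurableSet_injOn_cover`, proved by doubling sets with uncountable fibres into a Cantor
scheme) the arrows are covered by countably many Borel bisections, and a Feldman–Moore argument
extends pieces of these by units or by swaps to elements `τ k` of the full group through all arrows
(`SetGroupoid.IsDiscretePMP.exists_fullGroup_cover`). Thinning out the enumeration `(τ k x)⁻¹` of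
`𝒢^x` gives choice functions (`BorelSubgroupoid.exists_choiceFunctions`).

The units are split into those where at most two arrows start and the others
(`SetGroupoid.manyArrows`). Over the former, the full group of `𝒢 ⋉ Z` is commutative and there is
nothing to prove (`FullGroup.comp_comm_of_base_notMem`). Over the latter, a central sequence leaves
every Borel set of units asymptotically invariant (`IsCentralSeq.tendsto_measure_circ_notMem`):
isotropy at `x`, or two further points of its orbit, give elements of the full group whose supports
pin down pieces of the given Borel set.

The choice functions give coordinates on `Z`. To treat all indices at once, the products
`∏_{i < m} Y` are replaced by `Y^ℕ`, whose superfluous coordinates are never moved: in these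
coordinates the lift of `T` is a measure-preserving transformation `FullGroup.transport` of
`X × Y^ℕ` that permutes the coordinates and moves them by values of `α`. If `T_n` commutes with an
`R` in the full group for which `R x = ψ_i(x)⁻¹` both at `x` and at `T_n° x`, then
`T_n` fixes the class of `ψ_i(x)` and acts on the `i`-th coordinate by `α (T_n (R° x))`. Here
`T_n (R° x)` is distributed as `T_n x` is, because `R°` preserves `μ`; so the hypothesis on `α`
makes the sets `{ω | ω_i ∈ C}` asymptotically invariant (`IsCentralSeq.tendsto_coordinate`). The
asymptotically invariant sets form a `σ`-algebra (`asymptoticallyInvariant`). It contains the sets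
coming from `X` and from each coordinate, hence all measurable sets
(`IsCentralSeq.tendsto_transport`), and this carries over to `Z` (`IsCentralSeq.tendsto_lift_circ`).

Finally, let `S` be in the full group of `𝒢 ⋉ Z`. The sets `E_k` of all `z` over `x` at which the
arrow of `S z` is `τ k x` cover `Z`. At a point `z ∈ E_k` that the lift of `T_n` maps into `E_k`
again, the lift commutes with `S` as soon as `T_n` commutes with `τ k` at `x`
(`FullGroup.lift_comp_comm`). Both conditions fail only on sets of measure tending to `0`, and a
countable cover of a finite measure space may be treated member by member
(`tendsto_measure_zero_of_cover`).
-/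

/-! ### The Lusin–Novikov theorem -/

section LusinNovikov

/-- Membership in the `σ`-ideal generated by the Borel sets on which `f` is injective, recorded for
Borel sets only: `B` is a countable union of Borel sets on each of which `f` is injective. -/
def SigmaInjective {G X : Type*} [MeasurableSpace G] (f : G → X) (B : Set G) : Prop :=
  ∃ D : ℕ → Set G, (∀ n, MeasurableSet (D n) ∧ InjOn f (D n)) ∧ B = ⋃ n, D n

/-- A family of sets is fibrewise small for `f` if, up to `σ`-injective sets, no fibre of `f` meets
all members of the family. -/
def FiberSmall {G X ι : Type*} [MeasurableSpace G] (f : G → X) (A : ι → Set G) : Prop :=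
  ∃ B : ι → Set G, (∀ i, SigmaInjective f (B i)) ∧ ∀ x, ∃ i, f ⁻¹' {x} ∩ A i ⊆ B i

theorem SigmaInjective.measurableSet {G X : Type*} [MeasurableSpace G] {f : G → X} {B : Set G}
    (h : SigmaInjective f B) : MeasurableSet B := by
  obtain ⟨D, hD, rfl⟩ := h
  exact MeasurableSet.iUnion fun n => (hD n).1

theorem SigmaInjective.of_injOn {G X : Type*} [MeasurableSpace G] {f : G → X} {B : Set G}
    (hB : MeasurableSet B) (h : InjOn f B) : SigmaInjective f B :=
  ⟨fun _ => B, fun _ => ⟨hB, h⟩, (iUnion_const B).symm⟩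

theorem SigmaInjective.empty {G X : Type*} [MeasurableSpace G] (f : G → X) :
    SigmaInjective f ∅ :=
  .of_injOn MeasurableSet.empty (injOn_empty f)

theorem SigmaInjective.iUnion {G X κ : Type*} [MeasurableSpace G] [Countable κ] {f : G → X}
    {B : κ → Set G} (h : ∀ k, SigmaInjective f (B k)) : SigmaInjective f (⋃ k, B k) := by
  rcases isEmpty_or_nonempty κ with hκ | hκ
  · rw [iUnion_of_empty]; exact .empty f
  choose D hD hB using h
  obtain ⟨e, he⟩ := exists_surjective_nat (κ × ℕ)
  refine ⟨fun n => D (e n).1 (e n).2, fun n => hD _ _, ?_⟩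
  rw [he.iUnion_comp (g := fun p => D p.1 p.2), iUnion_prod']
  exact iUnion_congr hB

theorem SigmaInjective.union {G X : Type*} [MeasurableSpace G] {f : G → X}
    {A B : Set G} (hA : SigmaInjective f A) (hB : SigmaInjective f B) :
    SigmaInjective f (A ∪ B) := by
  rw [union_eq_iUnion]
  exact .iUnion (fun b => by cases b <;> assumption)

/-- Reindexing can only merge members of the family, which does not destroy smallness. -/
theorem FiberSmall.of_comp {G X ι κ : Type*} [MeasurableSpace G] [Countable κ] {f : G → X}
    {A : ι → Set G} (e : κ → ι) (h : FiberSmall f fun k => A (e k)) : FiberSmall f A := by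
  obtain ⟨B, hB, hx⟩ := h
  refine ⟨fun i => ⋃ k : {k // e k = i}, B k, fun i => .iUnion fun k => hB _, fun x => ?_⟩
  obtain ⟨k, hk⟩ := hx x
  exact ⟨e k, hk.trans (subset_iUnion (fun k' : {k' // e k' = e k} => B k') ⟨k, rfl⟩)⟩

theorem exists_fiber_meets_of_not_fiberSmall {G X ι : Type*} [MeasurableSpace G] {f : G → X}
    {A : ι → Set G} (h : ¬ FiberSmall f A) : ∃ x, ∀ i, (f ⁻¹' {x} ∩ A i).Nonempty := by
  by_contra! hx
  exact h ⟨fun _ => ∅, fun _ => .empty f, fun x => (hx x).imp fun i hi => hi.subset⟩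

theorem analyticSet_inter {G : Type*} [TopologicalSpace G] [T2Space G] {s t : Set G}
    (hs : AnalyticSet s) (ht : AnalyticSet t) : AnalyticSet (s ∩ t) := by
  rw [inter_eq_iInter]
  exact AnalyticSet.iInter (fun b => by cases b <;> assumption)

variable {G X : Type*} [TopologicalSpace G] [PolishSpace G] [MeasurableSpace G] [BorelSpace G]
  [TopologicalSpace X] [PolishSpace X]

/-- The points that share their fibre with another point of an analytic set form an analytic
set. -/
theorem analyticSet_exists_ne_mem_fiber {f : G → X} (hf : Continuous f) {D : Set G}
    (hD : AnalyticSet D) : AnalyticSet {g | ∃ h ∈ D, f g = f h ∧ g ≠ h} := by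
  have h1 : AnalyticSet (({p : G × G | f p.1 = f p.2} ∩ {p | p.1 ≠ p.2}) ∩ Prod.snd ⁻¹' D) := by
    refine analyticSet_inter (analyticSet_inter ?_ ?_) (hD.preimage continuous_snd)
    · exact (isClosed_eq (by fun_prop) (by fun_prop)).analyticSet
    · exact (isOpen_ne_fun continuous_fst continuous_snd).measurableSet.analyticSet
  convert h1.image_of_continuous continuous_fst using 1
  ext g
  constructor
  · rintro ⟨h, hh, e, n⟩
    exact ⟨(g, h), ⟨⟨e, n⟩, hh⟩, rfl⟩
  · rintro ⟨⟨g', h⟩, ⟨⟨e, n⟩, hh⟩, rfl⟩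
    exact ⟨h, hh, e, n⟩

/-- Two applications of Lusin separation: the first one removes from the fibres the points that
share them with a point of `D`, the second one those that share them with a point of the Borel set
found before. -/
theorem exists_measurableSet_injOn_of_analyticSet {f : G → X} (hf : Continuous f) {D : Set G}
    (hD : AnalyticSet D) (hi : InjOn f D) : ∃ B, D ⊆ B ∧ MeasurableSet B ∧ InjOn f B := by
  obtain ⟨B, hDB, hB, hBm⟩ := hD.measurablySeparable (analyticSet_exists_ne_mem_fiber hf hD) (by
    rw [Set.disjoint_left]
    rintro g hg ⟨h, hh, e, n⟩
    exact n (hi hg hh e))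
  obtain ⟨B', hDB', hB', hBm'⟩ := hD.measurablySeparable
    (analyticSet_exists_ne_mem_fiber hf hBm.analyticSet) (by
      rw [Set.disjoint_left]
      rintro g hg ⟨h, hh, e, n⟩
      exact Set.disjoint_left.1 hB ⟨g, hg, e.symm, n.symm⟩ hh)
  refine ⟨B ∩ B', subset_inter hDB hDB', hBm.inter hBm', ?_⟩
  intro g hg h hh e
  by_contra n
  exact Set.disjoint_left.1 hB' ⟨h, hh.1, e, n⟩ hg.2

/-- If two members of a family coincide and all ways of separating them by a countable family of
pairs of sets give small families, then the family is small: in the fibres that essentially meet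
the other members, the common member has essentially one point. -/
theorem FiberSmall.of_forall_separated {ι κ : Type*} [Finite ι] [DecidableEq ι] [Countable κ]
    {f : G → X} (hf : Continuous f) {A : ι → Set G} (hA : ∀ i, MeasurableSet (A i)) {i j : ι}
    (hij : i ≠ j) (hAij : A i = A j) {U V : κ → Set G}
    (hUV : ∀ g h, g ≠ h → ∃ k, g ∈ U k ∧ h ∈ V k)
    (hs : ∀ k, FiberSmall f
      (Function.update (Function.update A i (A i ∩ U k)) j (A j ∩ V k))) :
    FiberSmall f A := by
  choose B₀ hB₀ hx using hs
  set B : ι → Set G := fun l => ⋃ k, B₀ k l with hBdef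
  have hB : ∀ l, SigmaInjective f (B l) := fun l => .iUnion fun k => hB₀ k l
  have hsub : ∀ k l, B₀ k l ⊆ B l := fun k l => subset_iUnion (fun k => B₀ k l) k
  set C : ι → Set G := fun l => if l = i ∨ l = j then univ else f ⁻¹' (f '' (A l \ B l))
  have hC : ∀ l, AnalyticSet (C l) := by
    intro l
    by_cases hl : l = i ∨ l = j
    · simp only [C, hl, if_true]; exact MeasurableSet.univ.analyticSet
    · simp only [C, hl, if_false]
      exact ((((hA l).diff (hB l).measurableSet).analyticSet).image_of_continuous hf).preimage hf
  have : Nonempty ι := ⟨i⟩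
  have hmem : ∀ g, (∀ l, l ≠ i → l ≠ j → ¬ f ⁻¹' {f g} ∩ A l ⊆ B l) → g ∈ ⋂ l, C l := by
    intro g hg
    refine mem_iInter.2 fun l => ?_
    by_cases hl : l = i ∨ l = j
    · simp [C, hl]
    · simp only [C, hl, if_false]
      push Not at hl
      obtain ⟨h, ⟨hh, hhA⟩, hhB⟩ := not_subset.1 (hg l hl.1 hl.2)
      exact ⟨h, ⟨hhA, hhB⟩, hh⟩
  -- every separating pair fails in one of the two coordinates, so a fibre has at most one point
  -- left
  have hinj : InjOn f ((A i \ (B i ∪ B j)) ∩ ⋂ l, C l) := by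
    intro g hg h hh e
    by_contra hne
    obtain ⟨k, hgk, hhk⟩ := hUV g h hne
    obtain ⟨l, hl⟩ := hx k (f g)
    by_cases hlj : l = j
    · subst hlj
      rw [Function.update_self] at hl
      exact hh.1.2 (Or.inr (hsub k l (hl ⟨e.symm, hAij ▸ hh.1.1, hhk⟩)))
    rw [Function.update_of_ne hlj] at hl
    by_cases hli : l = i
    · subst hli
      rw [Function.update_self] at hl
      exact hg.1.2 (Or.inl (hsub k l (hl ⟨rfl, hg.1.1, hgk⟩)))
    rw [Function.update_of_ne hli] at hl
    have := mem_iInter.1 hg.2 l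
    simp only [C, hli, hlj, or_self, if_false] at this
    obtain ⟨g', ⟨hg'A, hg'B⟩, e'⟩ := this
    exact hg'B (hsub k l (hl ⟨e', hg'A⟩))
  obtain ⟨D, hD, hDm, hDi⟩ := exists_measurableSet_injOn_of_analyticSet hf
    (analyticSet_inter ((hA i).diff ((hB i).union (hB j)).measurableSet).analyticSet
      (AnalyticSet.iInter hC)) hinj
  refine ⟨Function.update B i ((B i ∪ B j) ∪ D), fun l => ?_, fun x => ?_⟩
  · by_cases hl : l = i
    · subst hl
      rw [Function.update_self]
      exact ((hB _).union (hB j)).union (.of_injOn hDm hDi)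
    · rw [Function.update_of_ne hl]; exact hB l
  · by_cases hc : ∃ l, l ≠ i ∧ l ≠ j ∧ f ⁻¹' {x} ∩ A l ⊆ B l
    · obtain ⟨l, hli, hlj, hl⟩ := hc
      exact ⟨l, by rwa [Function.update_of_ne hli]⟩
    · push Not at hc
      refine ⟨i, ?_⟩
      rw [Function.update_self]
      rintro g ⟨rfl, hg⟩
      by_cases hgB : g ∈ B i ∪ B j
      · exact Or.inl hgB
      · exact Or.inr (hD ⟨⟨hg, hgB⟩, hmem g hc⟩)

end LusinNovikov

section LusinNovikovMetric

variable {G X : Type*} [MetricSpace G] [CompleteSpace G] [SecondCountableTopology G]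
  [MeasurableSpace G] [BorelSpace G] [TopologicalSpace X] [PolishSpace X]

/-- Distinct points are separated by pairs of disjoint small closed balls with centres in a
countable dense set. -/
theorem exists_countable_separating_closed_pairs (G : Type*) [MetricSpace G]
    [SecondCountableTopology G] {ε : ℝ} (hε : 0 < ε) :
    ∃ U V : ℕ × ℕ × ℕ → Set G, (∀ k, IsClosed (U k) ∧ IsClosed (V k) ∧ Disjoint (U k) (V k) ∧
      (∀ x ∈ U k, ∀ y ∈ U k, dist x y ≤ ε) ∧ ∀ x ∈ V k, ∀ y ∈ V k, dist x y ≤ ε) ∧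
      ∀ g h, g ≠ h → ∃ k, g ∈ U k ∧ h ∈ V k := by
  classical
  rcases isEmpty_or_nonempty G with hG | hG
  · exact ⟨fun _ => ∅, fun _ => ∅, fun k => by simp, fun g => hG.elim g⟩
  let d := TopologicalSpace.denseSeq G
  let P : ℕ × ℕ × ℕ → Prop := fun k => (1 : ℝ) / (k.2.2 + 1) ≤ ε / 2 ∧
    Disjoint (Metric.closedBall (d k.1) (1 / (k.2.2 + 1)))
      (Metric.closedBall (d k.2.1) (1 / (k.2.2 + 1)))
  refine ⟨fun k => if P k then Metric.closedBall (d k.1) (1 / (k.2.2 + 1)) else ∅,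
    fun k => if P k then Metric.closedBall (d k.2.1) (1 / (k.2.2 + 1)) else ∅, fun k => ?_, ?_⟩
  · by_cases hk : P k
    · simp only [hk, if_true]
      refine ⟨Metric.isClosed_closedBall, Metric.isClosed_closedBall, hk.2, ?_, ?_⟩
      · intro x hx y hy
        have := dist_triangle_right x y (d k.1)
        have h1 := hk.1
        rw [Metric.mem_closedBall] at hx hy
        linarith
      · intro x hx y hy
        have := dist_triangle_right x y (d k.2.1)
        have h1 := hk.1
        rw [Metric.mem_closedBall] at hx hy
        linarith
    · simp [hk]
  · intro g h hgh
    have hpos : 0 < dist g h := dist_pos.2 hgh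
    obtain ⟨q, hq⟩ := exists_nat_one_div_lt
      (lt_min (half_pos hε) (by positivity : 0 < dist g h / 4))
    have hq1 := hq.trans_le (min_le_left _ _)
    have hq2 := hq.trans_le (min_le_right _ _)
    have hqpos : (0 : ℝ) < 1 / (q + 1) := by positivity
    obtain ⟨a, ha⟩ := Metric.denseRange_iff.1 (TopologicalSpace.denseRange_denseSeq G) g _ hqpos
    obtain ⟨b, hb⟩ := Metric.denseRange_iff.1 (TopologicalSpace.denseRange_denseSeq G) h _ hqpos
    have hP : P (a, b, q) := by
      refine ⟨hq1.le, Metric.closedBall_disjoint_closedBall ?_⟩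
      have h1 := dist_triangle4 g (d a) (d b) h
      rw [dist_comm (d b) h] at h1
      have ha' : dist g (d a) < 1 / (q + 1) := ha
      have hb' : dist h (d b) < 1 / (q + 1) := hb
      show (1 : ℝ) / (q + 1) + 1 / (q + 1) < _
      linarith
    refine ⟨(a, b, q), ?_, ?_⟩
    · simp only [hP, if_true]; exact ha.le
    · simp only [hP, if_true]; exact hb.le

/-- The members of a family that is not small can all be split into two disjoint closed sets of
small diameter, so that the doubled family is not small. -/
theorem exists_doubling {ι : Type*} [Finite ι] {f : G → X} (hf : Continuous f)
    {A : ι → Set G} (hA : ∀ i, IsClosed (A i)) (hs : ¬ FiberSmall f A) {ε : ℝ} (hε : 0 < ε) :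
    ∃ A' : ι × Bool → Set G, (∀ p, IsClosed (A' p)) ∧ ¬ FiberSmall f A' ∧ (∀ p, A' p ⊆ A p.1) ∧
      (∀ i, Disjoint (A' (i, true)) (A' (i, false))) ∧
      ∀ p, ∀ x ∈ A' p, ∀ y ∈ A' p, dist x y ≤ ε := by
  classical
  have := Fintype.ofFinite ι
  obtain ⟨U, V, hUV, hsep⟩ := exists_countable_separating_closed_pairs G hε
  suffices H : ∀ t : Finset ι, ∃ A' : ι × Bool → Set G, (∀ p, IsClosed (A' p)) ∧
      ¬ FiberSmall f A' ∧ (∀ p, A' p ⊆ A p.1) ∧ (∀ p, p.1 ∉ t → A' p = A p.1) ∧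
      (∀ i ∈ t, Disjoint (A' (i, true)) (A' (i, false))) ∧
      ∀ p, p.1 ∈ t → ∀ x ∈ A' p, ∀ y ∈ A' p, dist x y ≤ ε by
    obtain ⟨A', h1, h2, h3, -, h4, h5⟩ := H Finset.univ
    exact ⟨A', h1, h2, h3, fun i => h4 i (Finset.mem_univ i), fun p => h5 p (Finset.mem_univ _)⟩
  intro t
  induction t using Finset.induction_on with
  | empty =>
    exact ⟨fun p => A p.1, fun p => hA _, fun h => hs (.of_comp Prod.fst h), fun p => subset_rfl,
      fun p _ => rfl, fun i hi => by simp at hi, fun p hp => by simp at hp⟩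
  | insert i t hi ih =>
    obtain ⟨A', h1, h2, h3, h4, h5, h6⟩ := ih
    have hne : ((i, true) : ι × Bool) ≠ (i, false) := by simp
    have hex : ∃ k, ¬ FiberSmall f (Function.update (Function.update A' (i, true)
        (A' (i, true) ∩ U k)) (i, false) (A' (i, false) ∩ V k)) := by
      by_contra! hk
      exact h2 (.of_forall_separated hf (fun p => (h1 p).measurableSet) hne
        ((h4 (i, true) hi).trans (h4 (i, false) hi).symm) hsep hk)
    obtain ⟨k, hk⟩ := hex
    obtain ⟨hU, hV, hd, hdU, hdV⟩ := hUV k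
    set A'' := Function.update (Function.update A' (i, true)
        (A' (i, true) ∩ U k)) (i, false) (A' (i, false) ∩ V k) with hA''
    have e0 : A'' (i, false) = A' (i, false) ∩ V k := Function.update_self ..
    have e1 : A'' (i, true) = A' (i, true) ∩ U k := by
      rw [hA'', Function.update_of_ne hne, Function.update_self]
    have e2 : ∀ p : ι × Bool, p.1 ≠ i → A'' p = A' p := by
      intro p hp
      rw [hA'', Function.update_of_ne (fun e => hp (by rw [e])),
        Function.update_of_ne (fun e => hp (by rw [e]))]
    have key : ∀ (Q : ι × Bool → Prop), Q (i, true) → Q (i, false) → (∀ p, p.1 ≠ i → Q p) →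
        ∀ p, Q p := by
      rintro Q q1 q0 q ⟨j, b⟩
      by_cases hj : j = i
      · subst hj; cases b <;> assumption
      · exact q _ hj
    refine ⟨A'', ?_, hk, ?_, ?_, ?_, ?_⟩
    · apply key
      · rw [e1]; exact (h1 _).inter hU
      · rw [e0]; exact (h1 _).inter hV
      · intro p hp; rw [e2 p hp]; exact h1 p
    · apply key
      · rw [e1]; exact inter_subset_left.trans (h3 _)
      · rw [e0]; exact inter_subset_left.trans (h3 _)
      · intro p hp; rw [e2 p hp]; exact h3 p
    · intro p hp
      rw [Finset.mem_insert, not_or] at hp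
      rw [e2 p hp.1, h4 p hp.2]
    · intro j hj
      by_cases hji : j = i
      · subst hji
        rw [e0, e1]
        exact hd.mono inter_subset_right inter_subset_right
      · rw [e2 _ hji, e2 _ hji]
        exact h5 j ((Finset.mem_insert.1 hj).resolve_left hji)
    · apply key
      · rintro -; rw [e1]; exact fun x hx y hy => hdU x hx.2 y hy.2
      · rintro -; rw [e0]; exact fun x hx y hy => hdV x hx.2 y hy.2
      · intro p hp hpt; rw [e2 p hp]
        exact h6 p ((Finset.mem_insert.1 hpt).resolve_left hp)

/-- Iterating the doubling gives a Cantor scheme of closed sets whose `2 ^ n` members at level `n`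
all meet one fibre. The limit points of its branches are pairwise distinct and lie in one fibre. -/
theorem exists_uncountable_fiber {f : G → X} (hf : Continuous f)
    (hs : ¬ FiberSmall f fun _ : Unit => (univ : Set G)) :
    ∃ x, ¬ (f ⁻¹' {x}).Countable := by
  let St : ℕ → Type _ := fun n =>
    {A : (Fin n → Bool) → Set G // (∀ s, IsClosed (A s)) ∧ ¬ FiberSmall f A}
  have step : ∀ n (A : St n), ∃ A' : St (n + 1),
      (∀ s, A'.1 s ⊆ A.1 (Fin.init s)) ∧
      (∀ s t, Fin.init s = Fin.init t → s (Fin.last n) ≠ t (Fin.last n) →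
        Disjoint (A'.1 s) (A'.1 t)) ∧
      ∀ s, ∀ x ∈ A'.1 s, ∀ y ∈ A'.1 s, dist x y ≤ 1 / (n + 1) := by
    intro n A
    obtain ⟨A', h1, h2, h3, h4, h5⟩ := exists_doubling hf A.2.1 A.2.2
      (by positivity : (0 : ℝ) < 1 / (n + 1))
    refine ⟨⟨fun s => A' (Fin.init s, s (Fin.last n)), fun s => h1 _, fun h => h2 ?_⟩,
      fun s => h3 _, ?_, fun s => h5 _⟩
    · refine FiberSmall.of_comp (A := A')
        (fun s : Fin (n + 1) → Bool => (Fin.init s, s (Fin.last n))) h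
    · intro s t e ne
      show Disjoint (A' (Fin.init s, s (Fin.last n))) (A' (Fin.init t, t (Fin.last n)))
      rw [e]
      rcases hb : s (Fin.last n) with _ | _ <;> rcases hb' : t (Fin.last n) with _ | _
      · exact absurd (hb.trans hb'.symm) ne
      · exact (h4 _).symm
      · exact h4 _
      · exact absurd (hb.trans hb'.symm) ne
  choose next hn1 hn2 hn3 using step
  let A₀ : St 0 := ⟨fun _ => univ, fun _ => isClosed_univ, fun h => hs
    (FiberSmall.of_comp (fun _ : Fin 0 → Bool => ()) h)⟩
  let A : ∀ n, St n := fun n => Nat.rec A₀ (fun n a => next n a) n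
  let R : ∀ (c : ℕ → Bool) (n : ℕ), Fin n → Bool := fun c n i => c i
  have hanti : ∀ c n, (A (n + 1)).1 (R c (n + 1)) ⊆ (A n).1 (R c n) := fun c n =>
    hn1 n (A n) (R c (n + 1))
  have hdiam : ∀ c n, ∀ x ∈ (A (n + 1)).1 (R c (n + 1)), ∀ y ∈ (A (n + 1)).1 (R c (n + 1)),
      dist x y ≤ 1 / (n + 1) := fun c n => hn3 n (A n) (R c (n + 1))
  have hmono : ∀ c, Antitone fun n => (A n).1 (R c n) := fun c => antitone_nat_of_succ_le (hanti c)
  choose x hx using fun n => exists_fiber_meets_of_not_fiberSmall (A (n + 1)).2.2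
  choose p hp using hx
  have hlim : ∀ c : ℕ → Bool, ∃ g, Tendsto (fun n => p n (R c (n + 1))) atTop (𝓝 g) := by
    intro c
    refine cauchySeq_tendsto_of_complete
      (cauchySeq_of_le_tendsto_0 (fun n : ℕ => 1 / ((n : ℝ) + 1)) ?_
      tendsto_one_div_add_atTop_nhds_zero_nat)
    intro n m N hn hm
    exact hdiam c N _ (hmono c (show N + 1 ≤ n + 1 by lia) (hp n _).2)
      _ (hmono c (show N + 1 ≤ m + 1 by lia) (hp m _).2)
  choose g hg using hlim
  have hgA : ∀ c n, g c ∈ (A n).1 (R c n) := by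
    intro c n
    refine ((A n).2.1 _).mem_of_tendsto (hg c) ?_
    filter_upwards [eventually_ge_atTop n] with m hm
    exact hmono c (show n ≤ m + 1 by lia) (hp m _).2
  have hfg : ∀ c c', f (g c) = f (g c') := by
    intro c c'
    have h1 := (hf.tendsto _).comp (hg c)
    have h2 := (hf.tendsto _).comp (hg c')
    refine tendsto_nhds_unique h1 (h2.congr fun n => ?_)
    exact (hp n (R c' (n + 1))).1.trans (hp n (R c (n + 1))).1.symm
  have hinj : Function.Injective g := by
    intro c c' e
    funext n
    induction n using Nat.strong_induction_on with
    | _ n ih =>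
      by_contra hne
      refine Set.disjoint_left.1 (hn2 n (A n) (R c (n + 1)) (R c' (n + 1)) ?_ hne)
        (hgA c (n + 1)) (e ▸ hgA c' (n + 1))
      funext i
      exact ih i i.2
  refine ⟨f (g fun _ => true), fun hc => ?_⟩
  have : Countable (ℕ → Bool) := by
    have := hc.to_subtype
    exact Function.Injective.countable
      (f := fun c => (⟨g c, hfg c _⟩ : f ⁻¹' {f (g fun _ => true)}))
      fun c c' e => hinj (congrArg Subtype.val e)
  obtain ⟨e, he⟩ := exists_surjective_nat (ℕ → Bool)
  exact Function.cantor_surjective (fun n => {m | e n m = true}) fun s => by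
    classical
    obtain ⟨n, hn⟩ := he fun m => decide (m ∈ s)
    exact ⟨n, by ext m; simp [hn]⟩

end LusinNovikovMetric

/-- **Lusin–Novikov theorem**: the domain of a countable-to-one Borel map between standard Borel
spaces is a countable union of Borel sets on which the map is injective. -/
theorem exists_measurableSet_injOn_cover {G X : Type*} [MeasurableSpace G] [StandardBorelSpace G]
    [MeasurableSpace X] [StandardBorelSpace X] {f : G → X} (hf : Measurable f)
    (hc : ∀ x, (f ⁻¹' {x}).Countable) :
    ∃ D : ℕ → Set G, (∀ n, MeasurableSet (D n)) ∧ (∀ n, InjOn f (D n)) ∧ ∀ g, ∃ n, g ∈ D n := by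
  let _ := upgradeStandardBorel X
  -- a finer Polish topology with the same Borel sets makes `f` continuous
  obtain ⟨t, htc, htB, htP⟩ : ∃ t : TopologicalSpace G, Continuous f ∧ BorelSpace G ∧
      PolishSpace G := by
    let _ := upgradeStandardBorel G
    have hp : PolishSpace G := inferInstance
    obtain ⟨t', ht', hc', hp'⟩ := hf.exists_continuous
    refine ⟨t', hc', ⟨?_⟩, hp'⟩
    rw [eq_borel_upgradeStandardBorel G]
    exact (borel_eq_borel_of_le hp' hp ht').symm
  let _ := TopologicalSpace.upgradeIsCompletelyMetrizable G
  by_contra hno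
  obtain ⟨x, hx⟩ := exists_uncountable_fiber htc (fun ⟨B, hB, hx⟩ => hno (by
    obtain ⟨D, hD, hBD⟩ := hB ()
    refine ⟨D, fun n => (hD n).1, fun n => (hD n).2, fun g => ?_⟩
    obtain ⟨⟨⟩, hi⟩ := hx (f g)
    have := hi ⟨rfl, mem_univ g⟩
    rwa [hBD, mem_iUnion] at this))
  exact hx (hc x)

/-! ### Groupoids and their full groups -/

section groupoidAlgebra

variable {X G : Type*} (𝒢 : SetGroupoid X G)

open Classical in
/-- The multiplication of a groupoid as a total operation, with the value `g` at pairs `(g, h)` that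
cannot be composed. -/
noncomputable def SetGroupoid.pmul (g h : G) : G :=
  if hc : 𝒢.s g = 𝒢.r h then 𝒢.mul g h hc else g

variable {𝒢}

theorem SetGroupoid.mul_eq_pmul {g h : G} (hc : 𝒢.s g = 𝒢.r h) :
    𝒢.mul g h hc = 𝒢.pmul g h := by
  rw [pmul, dif_pos hc]

theorem SetGroupoid.s_pmul {g h : G} (hc : 𝒢.s g = 𝒢.r h) : 𝒢.s (𝒢.pmul g h) = 𝒢.s h := by
  rw [← mul_eq_pmul hc, 𝒢.s_mul]

theorem SetGroupoid.r_pmul {g h : G} (hc : 𝒢.s g = 𝒢.r h) : 𝒢.r (𝒢.pmul g h) = 𝒢.r g := by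
  rw [← mul_eq_pmul hc, 𝒢.r_mul]

theorem SetGroupoid.pmul_assoc {g h k : G} (hgh : 𝒢.s g = 𝒢.r h) (hhk : 𝒢.s h = 𝒢.r k) :
    𝒢.pmul (𝒢.pmul g h) k = 𝒢.pmul g (𝒢.pmul h k) := by
  rw [← mul_eq_pmul hgh, ← mul_eq_pmul hhk,
    ← mul_eq_pmul ((𝒢.s_mul g h hgh).trans hhk), 𝒢.mul_assoc g h k hgh hhk, mul_eq_pmul]

theorem SetGroupoid.unit_pmul {x : X} {g : G} (h : 𝒢.r g = x) : 𝒢.pmul (𝒢.unit x) g = g := by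
  subst h
  rw [← mul_eq_pmul (𝒢.s_unit _), 𝒢.unit_mul]

theorem SetGroupoid.pmul_unit {x : X} {g : G} (h : 𝒢.s g = x) : 𝒢.pmul g (𝒢.unit x) = g := by
  subst h
  rw [← mul_eq_pmul (𝒢.r_unit _).symm, 𝒢.mul_unit]

theorem SetGroupoid.inv_pmul_self (g : G) : 𝒢.pmul (𝒢.inv g) g = 𝒢.unit (𝒢.s g) := by
  rw [← mul_eq_pmul (𝒢.s_inv g), 𝒢.inv_mul]

theorem SetGroupoid.pmul_inv_self (g : G) : 𝒢.pmul g (𝒢.inv g) = 𝒢.unit (𝒢.r g) := by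
  rw [← mul_eq_pmul (𝒢.r_inv g).symm, 𝒢.mul_inv]

theorem SetGroupoid.inv_pmul_pmul {g h : G} (hc : 𝒢.s g = 𝒢.r h) :
    𝒢.pmul (𝒢.inv g) (𝒢.pmul g h) = h := by
  rw [← pmul_assoc (𝒢.s_inv g) hc, inv_pmul_self, unit_pmul hc.symm]

theorem SetGroupoid.pmul_inv_pmul {g h : G} (hc : 𝒢.r g = 𝒢.r h) :
    𝒢.pmul g (𝒢.pmul (𝒢.inv g) h) = h := by
  rw [← pmul_assoc (𝒢.r_inv g).symm ((𝒢.s_inv g).trans hc), pmul_inv_self, unit_pmul hc.symm]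

theorem SetGroupoid.pmul_pmul_inv {g h : G} (hc : 𝒢.s g = 𝒢.r h) :
    𝒢.pmul (𝒢.pmul g h) (𝒢.inv h) = g := by
  rw [pmul_assoc hc (𝒢.r_inv h).symm, pmul_inv_self, pmul_unit hc]

theorem SetGroupoid.pmul_left_cancel {g h k : G} (hh : 𝒢.s g = 𝒢.r h) (hk : 𝒢.s g = 𝒢.r k)
    (e : 𝒢.pmul g h = 𝒢.pmul g k) : h = k := by
  rw [← inv_pmul_pmul hh, e, inv_pmul_pmul hk]

theorem SetGroupoid.pmul_right_cancel {g h k : G} (hg : 𝒢.s g = 𝒢.r k) (hh : 𝒢.s h = 𝒢.r k)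
    (e : 𝒢.pmul g k = 𝒢.pmul h k) : g = h := by
  rw [← pmul_pmul_inv hg, e, pmul_pmul_inv hh]

theorem SetGroupoid.inv_pmul {g h : G} (hc : 𝒢.s g = 𝒢.r h) :
    𝒢.inv (𝒢.pmul g h) = 𝒢.pmul (𝒢.inv h) (𝒢.inv g) := by
  rw [← mul_eq_pmul hc, 𝒢.inv_mul_rev, mul_eq_pmul]

theorem SetGroupoid.inv_pmul_pmul_pmul {k a b : G} (h : 𝒢.s k = 𝒢.r a) (h' : 𝒢.r a = 𝒢.r b) :
    𝒢.pmul (𝒢.inv (𝒢.pmul k a)) (𝒢.pmul k b) = 𝒢.pmul (𝒢.inv a) b := by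
  rw [inv_pmul h, pmul_assoc (by rw [𝒢.s_inv, 𝒢.r_inv, h])
    (by rw [𝒢.s_inv, r_pmul (h.trans h')]), inv_pmul_pmul (h.trans h')]

theorem SetGroupoid.inv_injective : Function.Injective 𝒢.inv :=
  Function.LeftInverse.injective 𝒢.inv_inv

end groupoidAlgebra

section fullGroup

variable {X G : Type*} [MeasurableSpace X] [MeasurableSpace G] {𝒢 : SetGroupoid X G}

/-- The transformation `T° = r ∘ T` of the unit space induced by an element of the full group. -/
def FullGroup.circ (T : FullGroup 𝒢) (x : X) : X := 𝒢.r (T.toFun x)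

theorem FullGroup.comp_eq_pmul (S T : FullGroup 𝒢) (x : X) :
    S.comp T x = 𝒢.pmul (S.toFun (T.circ x)) (T.toFun x) :=
  SetGroupoid.mul_eq_pmul _

theorem FullGroup.source_comp (S T : FullGroup 𝒢) (x : X) : 𝒢.s (S.comp T x) = x :=
  (𝒢.s_mul _ _ _).trans (T.source x)

theorem FullGroup.range_comp (S T : FullGroup 𝒢) (x : X) :
    𝒢.r (S.comp T x) = S.circ (T.circ x) :=
  𝒢.r_mul _ _ _

/-- In a unit `x` that is the source of at most two arrows, all elements of the full group commute:
if `T x` and `S x` differ then one of them is the unit, and injectivity of `T°` and `S°` forces both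
compositions to be the other arrow. -/
theorem FullGroup.comp_comm_of_source_le_two (S T : FullGroup 𝒢) {x : X}
    (hx : ∀ g h, 𝒢.s g = x → 𝒢.s h = x → g ≠ 𝒢.unit x → h ≠ 𝒢.unit x → g = h) :
    T.comp S x = S.comp T x := by
  have hT := T.source x
  have hS := S.source x
  have unit_of : ∀ (T : FullGroup 𝒢) {g : G}, 𝒢.s g = x → g ≠ 𝒢.unit x →
      𝒢.pmul (T.toFun (𝒢.r g)) g = 𝒢.unit x → T.toFun x = 𝒢.unit x → False := by
    intro T g hg hne e e'
    -- `T (r g)` is the inverse of `g`, so `T°` takes the value `x` both in `r g` and in `x`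
    have h1 : T.circ (𝒢.r g) = x := by
      rw [circ, ← SetGroupoid.r_pmul (T.source (𝒢.r g)), e, 𝒢.r_unit]
    have h2 : T.circ x = x := by rw [circ, e', 𝒢.r_unit]
    have h3 : 𝒢.r g = x := T.injective (h1.trans h2.symm)
    rw [h3, e', SetGroupoid.unit_pmul h3] at e
    exact hne e
  have one : ∀ S T : FullGroup 𝒢, T.toFun x = 𝒢.unit x → S.toFun x ≠ 𝒢.unit x →
      T.comp S x = S.comp T x := by
    intro S T e hne
    have h1 : T.circ x = x := by rw [circ, e, 𝒢.r_unit]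
    have h2 : S.comp T x = S.toFun x := by
      rw [comp_eq_pmul, h1, e, SetGroupoid.pmul_unit (S.source x)]
    rw [h2]
    refine hx _ _ (source_comp _ _ _) (S.source x) (fun e' => ?_) hne
    rw [comp_eq_pmul] at e'
    exact unit_of T (S.source x) hne e' e
  by_cases hT1 : T.toFun x = 𝒢.unit x
  · by_cases hS1 : S.toFun x = 𝒢.unit x
    · rw [comp_eq_pmul, comp_eq_pmul, circ, circ, hT1, hS1, 𝒢.r_unit, hT1, hS1]
    · exact one S T hT1 hS1
  · by_cases hS1 : S.toFun x = 𝒢.unit x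
    · exact (one T S hS1 hT1).symm
    · have e : S.toFun x = T.toFun x := hx _ _ hS hT hS1 hT1
      by_cases hr : T.circ x = x
      · have hr' : S.circ x = x := by rw [circ, e]; exact hr
        rw [comp_eq_pmul, comp_eq_pmul, hr, hr', e]
      · have hu : ∀ P Q : FullGroup 𝒢, P.toFun x = Q.toFun x → P.circ x ≠ x →
            Q.toFun x ≠ 𝒢.unit x → P.comp Q x = 𝒢.unit x := by
          intro P Q e hP hQ
          by_contra hne
          have h1 := hx _ _ (source_comp P Q x) (Q.source x) hne hQ
          have h2 : P.circ (Q.circ x) = P.circ x := by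
            rw [← range_comp, h1, circ, e]
          apply hP
          rw [show P.circ x = Q.circ x by rw [circ, circ, e]]
          exact P.injective h2
        rw [hu T S e.symm hr hS1, hu S T e (by rwa [circ, e]) hT1]

end fullGroup

/-- A Borel map that is injective on a Borel set has a Borel section there, with a prescribed Borel
extension to the complement of the image. -/
theorem exists_measurable_section {G X : Type*} [MeasurableSpace G] [StandardBorelSpace G]
    [MeasurableSpace X] [StandardBorelSpace X] {f : G → X} (hf : Measurable f) {D : Set G}
    (hD : MeasurableSet D) (hi : InjOn f D) {u : X → G} (hu : Measurable u) :
    ∃ σ : X → G, Measurable σ ∧ (∀ g ∈ D, σ (f g) = g) ∧ ∀ x, x ∉ f '' D → σ x = u x := by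
  classical
  let σ : X → G := fun x => if h : x ∈ f '' D then h.choose else u x
  have h1 : ∀ g ∈ D, σ (f g) = g := by
    intro g hg
    have h : f g ∈ f '' D := mem_image_of_mem f hg
    simp only [σ, dif_pos h]
    exact hi h.choose_spec.1 hg h.choose_spec.2
  have h2 : ∀ x, x ∉ f '' D → σ x = u x := fun x hx => dif_neg hx
  refine ⟨σ, fun E hE => ?_, h1, h2⟩
  have : σ ⁻¹' E = f '' (D ∩ E) ∪ ((f '' D)ᶜ ∩ u ⁻¹' E) := by
    ext x
    by_cases hx : x ∈ f '' D
    · obtain ⟨g, hg, rfl⟩ := hx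
      simp only [mem_preimage, h1 g hg, mem_union, mem_inter_iff, mem_compl_iff]
      constructor
      · exact fun h => Or.inl ⟨g, ⟨hg, h⟩, rfl⟩
      · rintro (⟨g', ⟨hg', h⟩, e⟩ | h)
        · rwa [← hi hg' hg e]
        · exact absurd (mem_image_of_mem f hg) h.1
    · simp only [mem_preimage, h2 x hx, mem_union, mem_inter_iff, mem_compl_iff, hx,
        not_false_eq_true, true_and]
      exact ⟨Or.inr, fun h => h.resolve_left fun h => hx (image_mono inter_subset_left h)⟩
  rw [this]
  exact ((hD.inter hE).image_of_measurable_injOn hf (hi.mono inter_subset_left)).union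
    ((hD.image_of_measurable_injOn hf hi).compl.inter (hu hE))

theorem exists_separating_seq (X : Type*) [MeasurableSpace X] [StandardBorelSpace X] :
    ∃ P : ℕ → Set X, (∀ i, MeasurableSet (P i)) ∧ ∀ x y, x ≠ y → ∃ i, x ∈ P i ∧ y ∉ P i := by
  obtain ⟨f, hf, hi⟩ := MeasurableSpace.measurable_injection_nat_bool_of_countablySeparated X
  obtain ⟨e, he⟩ := exists_surjective_nat (ℕ × Bool)
  refine ⟨fun k => {x | f x (e k).1 = (e k).2}, fun k => ?_, fun x y hxy => ?_⟩
  · exact measurableSet_eq_fun ((measurable_pi_apply _).comp hf) measurable_const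
  · obtain ⟨n, hn⟩ := Function.ne_iff.1 (hi.ne hxy)
    obtain ⟨k, hk⟩ := he (n, f x n)
    exact ⟨k, by simp [hk], by simpa [hk] using hn.symm⟩

section discrete

variable {X G : Type*} [MeasurableSpace X] [MeasurableSpace G] {𝒢 : SetGroupoid X G} {μ : Measure X}

theorem SetGroupoid.IsDiscretePMP.measurable_pmul (h𝒢 : 𝒢.IsDiscretePMP μ) :
    Measurable fun p : G × G => 𝒢.pmul p.1 p.2 := by
  classical
  have := h𝒢.standardBorel_units
  exact Measurable.dite (s := {p : G × G | 𝒢.s p.1 = 𝒢.r p.2}) h𝒢.measurable_mul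
    (measurable_fst.comp measurable_subtype_coe)
    (measurableSet_eq_fun (h𝒢.measurable_s.comp measurable_fst)
      (h𝒢.measurable_r.comp measurable_snd))

theorem FullGroup.measurable_circ (h𝒢 : 𝒢.IsDiscretePMP μ) (T : FullGroup 𝒢) :
    Measurable T.circ :=
  h𝒢.measurable_r.comp T.measurable

theorem SetGroupoid.IsDiscretePMP.exists_bisection_cover (h𝒢 : 𝒢.IsDiscretePMP μ) :
    ∃ D : ℕ → Set G, (∀ k, MeasurableSet (D k)) ∧ (∀ k, InjOn 𝒢.s (D k)) ∧
      (∀ k, InjOn 𝒢.r (D k)) ∧ ∀ g, ∃ k, g ∈ D k := by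
  have := h𝒢.standardBorel_units
  have := h𝒢.standardBorel_arrows
  obtain ⟨D, hDm, hDi, hD⟩ := exists_measurableSet_injOn_cover h𝒢.measurable_s h𝒢.countable_s
  obtain ⟨E, hEm, hEi, hE⟩ := exists_measurableSet_injOn_cover h𝒢.measurable_r h𝒢.countable_r
  obtain ⟨e, he⟩ := exists_surjective_nat (ℕ × ℕ)
  refine ⟨fun k => D (e k).1 ∩ E (e k).2, fun k => (hDm _).inter (hEm _),
    fun k => (hDi _).mono inter_subset_left, fun k => (hEi _).mono inter_subset_right, fun g => ?_⟩
  obtain ⟨i, hi⟩ := hD g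
  obtain ⟨j, hj⟩ := hE g
  obtain ⟨k, hk⟩ := he (i, j)
  exact ⟨k, by simp only [hk]; exact ⟨hi, hj⟩⟩

/-- A Borel bisection whose sets of sources and of ranges coincide extends by units to an element of
the full group. -/
theorem FullGroup.exists_of_bisection (h𝒢 : 𝒢.IsDiscretePMP μ) {D : Set G} (hD : MeasurableSet D)
    (hs : InjOn 𝒢.s D) (hr : InjOn 𝒢.r D) (heq : 𝒢.s '' D = 𝒢.r '' D) :
    ∃ S : FullGroup 𝒢, (∀ g ∈ D, S.toFun (𝒢.s g) = g) ∧
      ∀ x, x ∉ 𝒢.s '' D → S.toFun x = 𝒢.unit x := by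
  have := h𝒢.standardBorel_units
  have := h𝒢.standardBorel_arrows
  obtain ⟨σ, hσ, h1, h2⟩ := exists_measurable_section h𝒢.measurable_s hD hs h𝒢.measurable_unit
  refine ⟨⟨σ, hσ, fun x => ?_, fun x y e => ?_⟩, h1, h2⟩
  · by_cases hx : x ∈ 𝒢.s '' D
    · obtain ⟨g, hg, rfl⟩ := hx
      rw [h1 g hg]
    · rw [h2 x hx, 𝒢.s_unit]
  · simp only at e
    by_cases hx : x ∈ 𝒢.s '' D <;> by_cases hy : y ∈ 𝒢.s '' D
    · obtain ⟨g, hg, rfl⟩ := hx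
      obtain ⟨h, hh, rfl⟩ := hy
      rw [h1 g hg, h1 h hh] at e
      rw [hr hg hh e]
    · obtain ⟨g, hg, rfl⟩ := hx
      rw [h1 g hg, h2 y hy, 𝒢.r_unit] at e
      exact absurd (heq ▸ e ▸ mem_image_of_mem 𝒢.r hg) hy
    · obtain ⟨g, hg, rfl⟩ := hy
      rw [h1 g hg, h2 x hx, 𝒢.r_unit] at e
      exact absurd (heq ▸ e ▸ mem_image_of_mem 𝒢.r hg) hx
    · rwa [h2 x hx, h2 y hy, 𝒢.r_unit, 𝒢.r_unit] at e

/-- A Borel bisection with disjoint sets of sources and of ranges extends to an element of the full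
group that swaps these two sets. -/
theorem FullGroup.exists_swap (h𝒢 : 𝒢.IsDiscretePMP μ) {D : Set G} (hD : MeasurableSet D)
    (hs : InjOn 𝒢.s D) (hr : InjOn 𝒢.r D) (hd : Disjoint (𝒢.s '' D) (𝒢.r '' D)) :
    ∃ S : FullGroup 𝒢, (∀ g ∈ D, S.toFun (𝒢.s g) = g) ∧
      ∀ x, x ∉ 𝒢.s '' D → x ∉ 𝒢.r '' D → S.toFun x = 𝒢.unit x := by
  have hsi : 𝒢.s '' (𝒢.inv ⁻¹' D) = 𝒢.r '' D := by
    ext x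
    constructor
    · rintro ⟨g, hg, rfl⟩; exact ⟨_, hg, 𝒢.r_inv g⟩
    · rintro ⟨g, hg, rfl⟩; exact ⟨𝒢.inv g, by rwa [mem_preimage, 𝒢.inv_inv], 𝒢.s_inv g⟩
  have hri : 𝒢.r '' (𝒢.inv ⁻¹' D) = 𝒢.s '' D := by
    ext x
    constructor
    · rintro ⟨g, hg, rfl⟩; exact ⟨_, hg, 𝒢.s_inv g⟩
    · rintro ⟨g, hg, rfl⟩; exact ⟨𝒢.inv g, by rwa [mem_preimage, 𝒢.inv_inv], 𝒢.r_inv g⟩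
  have hsi' : InjOn 𝒢.s (𝒢.inv ⁻¹' D) := fun g hg h hh e =>
    𝒢.inv_injective (hr hg hh (by rwa [𝒢.r_inv, 𝒢.r_inv]))
  have hri' : InjOn 𝒢.r (𝒢.inv ⁻¹' D) := fun g hg h hh e =>
    𝒢.inv_injective (hs hg hh (by rwa [𝒢.s_inv, 𝒢.s_inv]))
  have union_inj : ∀ {f : G → X} {A B : Set G}, InjOn f A → InjOn f B →
      Disjoint (f '' A) (f '' B) → InjOn f (A ∪ B) := by
    intro f A B hA hB h
    refine (injOn_union (Disjoint.of_image h)).2 ⟨hA, hB, fun a ha b hb e => ?_⟩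
    exact Set.disjoint_left.1 h (mem_image_of_mem f ha) (e ▸ mem_image_of_mem f hb)
  obtain ⟨S, h1, h2⟩ := exists_of_bisection h𝒢 (hD.union (h𝒢.measurable_inv hD))
    (union_inj hs hsi' (hsi ▸ hd)) (union_inj hr hri' (hri ▸ hd.symm))
    (by rw [image_union, image_union, hsi, hri, union_comm])
  refine ⟨S, fun g hg => h1 g (Or.inl hg), fun x hx hx' => h2 x ?_⟩
  rw [image_union, hsi]
  rintro (h | h)
  · exact hx h
  · exact hx' h

/-- A **Feldman–Moore** theorem for groupoids: countably many elements of the full group pass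
through all arrows. -/
theorem SetGroupoid.IsDiscretePMP.exists_fullGroup_cover (h𝒢 : 𝒢.IsDiscretePMP μ) :
    ∃ τ : ℕ → FullGroup 𝒢, ∀ g, ∃ k, (τ k).toFun (𝒢.s g) = g := by
  have := h𝒢.standardBorel_units
  obtain ⟨D, hDm, hDs, hDr, hD⟩ := h𝒢.exists_bisection_cover
  obtain ⟨P, hPm, hP⟩ := exists_separating_seq X
  -- isotropy pieces extend by units, pieces with disjoint sources and ranges extend to swaps
  have h1 : ∀ k, ∃ S : FullGroup 𝒢, ∀ g ∈ D k ∩ {g | 𝒢.s g = 𝒢.r g}, S.toFun (𝒢.s g) = g := by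
    intro k
    obtain ⟨S, hS, -⟩ := FullGroup.exists_of_bisection h𝒢
      ((hDm k).inter (measurableSet_eq_fun h𝒢.measurable_s h𝒢.measurable_r))
      ((hDs k).mono inter_subset_left) ((hDr k).mono inter_subset_left)
      (image_congr fun g hg => hg.2)
    exact ⟨S, hS⟩
  have h2 : ∀ p : ℕ × ℕ, ∃ S : FullGroup 𝒢,
      ∀ g ∈ D p.1 ∩ (𝒢.s ⁻¹' P p.2 ∩ 𝒢.r ⁻¹' (P p.2)ᶜ), S.toFun (𝒢.s g) = g := by
    intro p
    obtain ⟨S, hS, -⟩ := FullGroup.exists_swap h𝒢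
      ((hDm p.1).inter ((h𝒢.measurable_s (hPm p.2)).inter (h𝒢.measurable_r (hPm p.2).compl)))
      ((hDs p.1).mono inter_subset_left) ((hDr p.1).mono inter_subset_left) (by
        rw [Set.disjoint_left]
        rintro _ ⟨g, hg, rfl⟩ ⟨h, hh, e⟩
        exact hh.2.2 (e ▸ hg.2.1))
    exact ⟨S, hS⟩
  choose S₁ hS₁ using h1
  choose S₂ hS₂ using h2
  obtain ⟨e, he⟩ := exists_surjective_nat (ℕ ⊕ ℕ × ℕ)
  refine ⟨fun k => Sum.elim S₁ S₂ (e k), fun g => ?_⟩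
  obtain ⟨k, hk⟩ := hD g
  by_cases hg : 𝒢.s g = 𝒢.r g
  · obtain ⟨n, hn⟩ := he (Sum.inl k)
    exact ⟨n, by simp only [hn]; exact hS₁ k g ⟨hk, hg⟩⟩
  · obtain ⟨i, hi, hi'⟩ := hP _ _ hg
    obtain ⟨n, hn⟩ := he (Sum.inr (k, i))
    exact ⟨n, by simp only [hn]; exact hS₂ (k, i) g ⟨hk, hi, hi'⟩⟩

theorem SetGroupoid.IsDiscretePMP.measure_image_s_eq (h𝒢 : 𝒢.IsDiscretePMP μ) {D : Set G}
    (hD : MeasurableSet D) (hs : InjOn 𝒢.s D) (hr : InjOn 𝒢.r D) :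
    μ (𝒢.s '' D) = μ (𝒢.r '' D) := by
  have := h𝒢.standardBorel_units
  have := h𝒢.standardBorel_arrows
  have key : ∀ f : G → X, Measurable f → InjOn f D →
      ∫⁻ x, Measure.count (D ∩ {g | f g = x}) ∂μ = μ (f '' D) := by
    intro f hf hi
    rw [← lintegral_indicator_one (hD.image_of_measurable_injOn hf hi)]
    refine lintegral_congr fun x => ?_
    by_cases hx : x ∈ f '' D
    · obtain ⟨g, hg, rfl⟩ := hx
      have : D ∩ {h | f h = f g} = {g} := by
        ext h
        exact ⟨fun h' => hi h'.1 hg h'.2, fun h' => by rw [mem_singleton_iff.1 h']; exact ⟨hg, rfl⟩⟩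
      rw [this, Measure.count_singleton, indicator_of_mem (mem_image_of_mem f hg), Pi.one_apply]
    · have : D ∩ {h | f h = x} = ∅ := by
        rw [eq_empty_iff_forall_notMem]
        exact fun h hh => hx ⟨h, hh.1, hh.2⟩
      rw [this, measure_empty, indicator_of_notMem hx]
  rw [← key 𝒢.s h𝒢.measurable_s hs, ← key 𝒢.r h𝒢.measurable_r hr]
  exact (h𝒢.measure_eq D hD).symm

theorem FullGroup.measurePreserving_circ (h𝒢 : 𝒢.IsDiscretePMP μ) (T : FullGroup 𝒢) :
    MeasurePreserving T.circ μ μ := by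
  have := h𝒢.standardBorel_units
  have := h𝒢.standardBorel_arrows
  have := h𝒢.isProbabilityMeasure
  have hTi : Function.Injective T.toFun := fun x y e => by
    rw [← T.source x, e, T.source]
  have hri : InjOn 𝒢.r (range T.toFun) := by
    rintro _ ⟨x, rfl⟩ _ ⟨y, rfl⟩ e
    rw [T.injective e]
  have hsi : InjOn 𝒢.s (range T.toFun) := by
    rintro _ ⟨x, rfl⟩ _ ⟨y, rfl⟩ e
    rw [T.source, T.source] at e
    rw [e]
  have key : ∀ A, MeasurableSet A → μ A = μ (T.circ '' A) := by
    intro A hA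
    have h := h𝒢.measure_image_s_eq (hA.image_of_measurable_injOn T.measurable hTi.injOn)
      (hsi.mono (image_subset_range _ _)) (hri.mono (image_subset_range _ _))
    rw [image_image, image_image] at h
    simp only [T.source, image_id'] at h
    exact h
  have hc := T.measurable_circ h𝒢
  refine ⟨hc, Measure.ext fun A hA => ?_⟩
  rw [Measure.map_apply hc hA, key _ (hc hA), image_preimage_eq_inter_range]
  have hrm : MeasurableSet (range T.circ) := by
    rw [← image_univ]
    exact MeasurableSet.univ.image_of_measurable_injOn hc T.injective.injOn
  refine measure_inter_conull ?_
  have hfull : μ (range T.circ) = 1 := by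
    rw [← image_univ, ← key _ MeasurableSet.univ, measure_univ]
  exact (prob_compl_eq_zero_iff hrm).2 hfull

end discrete

/-! ### Choice functions -/

section choice

theorem lt_card_subtype_iff_exists_count_eq (p : ℕ → Prop) [DecidablePred p] (i : ℕ) :
    (i : ℕ∞) < ENat.card {n // p n} ↔ ∃ n, p n ∧ Nat.count p n = i := by
  change (i : ℕ∞) < Set.encard {n | p n} ↔ _
  by_cases hf : {n | p n}.Finite
  · rw [hf.encard_eq_coe_toFinset_card, Nat.cast_lt]
    constructor
    · exact fun h => ⟨Nat.nth p i, Nat.nth_mem_of_lt_card hf h,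
        Nat.count_nth_of_lt_card_finite hf h⟩
    · rintro ⟨n, hn, rfl⟩
      exact Nat.count_lt_card hf hn
  · rw [Set.Infinite.encard_eq hf]
    exact ⟨fun _ => ⟨Nat.nth p i, Nat.nth_mem_of_infinite hf i, Nat.count_nth_of_infinite hf i⟩,
      fun _ => ENat.natCast_lt_top i⟩

variable {X G : Type*} [MeasurableSpace G] {𝒢 : SetGroupoid X G}

theorem BorelSubgroupoid.cosetSetoid_iff (𝒮 : BorelSubgroupoid 𝒢) {x : X}
    (g h : {g // 𝒢.r g = x}) :
    𝒮.cosetSetoid x g h ↔ 𝒢.pmul (𝒢.inv g) h ∈ 𝒮.carrier := by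
  rw [← SetGroupoid.mul_eq_pmul ((𝒢.s_inv _).trans (g.2.trans h.2.symm))]
  rfl

/-- Left translation by `g` identifies the equivalence classes over `s g` with those over `r g`. -/
theorem BorelSubgroupoid.index_r (𝒮 : BorelSubgroupoid 𝒢) (g : G) :
    𝒮.index (𝒢.r g) = 𝒮.index (𝒢.s g) := by
  refine ENat.card_congr (Quotient.congr (ra := 𝒮.cosetSetoid _) (rb := 𝒮.cosetSetoid _)
    ⟨fun a => ⟨𝒢.pmul (𝒢.inv g) a, (SetGroupoid.r_pmul ((𝒢.s_inv g).trans a.2.symm)).trans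
        (𝒢.r_inv g)⟩,
      fun a => ⟨𝒢.pmul g a, SetGroupoid.r_pmul a.2.symm⟩,
      fun a => Subtype.ext (SetGroupoid.pmul_inv_pmul a.2.symm),
      fun a => Subtype.ext (SetGroupoid.inv_pmul_pmul a.2.symm)⟩ fun a b => ?_)
  rw [cosetSetoid_iff, cosetSetoid_iff]
  simp only [Equiv.coe_fn_mk]
  rw [SetGroupoid.inv_pmul_pmul_pmul ((𝒢.s_inv g).trans a.2.symm) (a.2.trans b.2.symm)]

variable [MeasurableSpace X] {μ : Measure X}

/-- An enumeration of the fibres `r⁻¹(x)` by Borel maps is thinned out to one of the classes: the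
`i`-th choice function picks the `i`-th member of the enumeration that is not equivalent to an
earlier one. -/
theorem BorelSubgroupoid.exists_choiceFunctions (h𝒢 : 𝒢.IsDiscretePMP μ)
    (𝒮 : BorelSubgroupoid 𝒢) :
    Nonempty (ChoiceFunctions 𝒮) ∧ ∀ i : ℕ, MeasurableSet {x | (i : ℕ∞) < 𝒮.index x} := by
  classical
  obtain ⟨τ, hτ⟩ := h𝒢.exists_fullGroup_cover
  let φ : ℕ → X → G := fun n x => 𝒢.inv ((τ n).toFun x)
  have hφm : ∀ n, Measurable (φ n) := fun n => h𝒢.measurable_inv.comp (τ n).measurable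
  have hφr : ∀ n x, 𝒢.r (φ n x) = x := fun n x => (𝒢.r_inv _).trans ((τ n).source x)
  have hφ : ∀ x (g : {g // 𝒢.r g = x}), ∃ n, φ n x = g := by
    intro x g
    obtain ⟨n, hn⟩ := hτ (𝒢.inv g)
    rw [𝒢.s_inv, g.2] at hn
    exact ⟨n, by simp only [φ]; rw [hn, 𝒢.inv_inv]⟩
  let φ' : ∀ (_ : ℕ) (x : X), {g // 𝒢.r g = x} := fun n x => ⟨φ n x, hφr n x⟩
  -- `p x n`: the `n`-th member of the enumeration is not equivalent to an earlier one
  let p : X → ℕ → Prop := fun x n => ∀ m < n, ¬ 𝒮.cosetSetoid x (φ' m x) (φ' n x)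
  have hpm : ∀ n, MeasurableSet {x | p x n} := by
    intro n
    have : {x | p x n} = ⋂ m, ⋂ _ : m < n,
        (fun x => 𝒢.pmul (𝒢.inv (φ m x)) (φ n x)) ⁻¹' 𝒮.carrierᶜ := by
      ext x
      simp only [mem_iInter]
      exact forall₂_congr fun m _ => not_congr (𝒮.cosetSetoid_iff _ _)
    rw [this]
    refine MeasurableSet.iInter fun m => MeasurableSet.iInter fun _ => ?_
    exact (h𝒢.measurable_pmul.comp ((h𝒢.measurable_inv.comp (hφm m)).prodMk (hφm n)))
      𝒮.measurableSet.compl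
  have hcm : ∀ n, Measurable fun x => Nat.count (p x) n := by
    intro n
    induction n with
    | zero => simp only [Nat.count_zero]; exact measurable_const
    | succ n ih =>
      simp only [Nat.count_succ]
      exact ih.add (Measurable.ite (hpm n) measurable_const measurable_const)
  let Q : ℕ → ℕ → Set X := fun i n => {x | p x n ∧ Nat.count (p x) n = i}
  have hQm : ∀ i n, MeasurableSet (Q i n) := fun i n =>
    (hpm n).inter (hcm n (measurableSet_singleton i))
  have hnew : ∀ x (g : {g // 𝒢.r g = x}), ∃ n, p x n ∧ 𝒮.cosetSetoid x g (φ' n x) := by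
    intro x g
    have hex : ∃ n, 𝒮.cosetSetoid x g (φ' n x) := by
      obtain ⟨n, hn⟩ := hφ x g
      refine ⟨n, ?_⟩
      rw [show φ' n x = g from Subtype.ext hn]
    refine ⟨Nat.find hex, fun m hm h => Nat.find_min hex hm ?_, Nat.find_spec hex⟩
    exact (𝒮.cosetSetoid x).trans (Nat.find_spec hex) ((𝒮.cosetSetoid x).symm h)
  have hpinj : ∀ x n m, p x n → p x m → 𝒮.cosetSetoid x (φ' n x) (φ' m x) → n = m := by
    intro x n m hn hm h
    rcases lt_trichotomy n m with hlt | he | hlt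
    · exact absurd h (hm n hlt)
    · exact he
    · exact absurd ((𝒮.cosetSetoid x).symm h) (hn m hlt)
  have hindex : ∀ x, 𝒮.index x = ENat.card {n // p x n} := by
    intro x
    refine (ENat.card_congr (Equiv.ofBijective
      (fun n : {n // p x n} => (Quotient.mk (𝒮.cosetSetoid x) (φ' n x))) ⟨?_, ?_⟩)).symm
    · intro n m e
      exact Subtype.ext (hpinj x n m n.2 m.2 (Quotient.exact e))
    · intro q
      induction q using Quotient.inductionOn with
      | _ g =>
        obtain ⟨n, hn, hg⟩ := hnew x g
        exact ⟨⟨n, hn⟩, Quotient.sound ((𝒮.cosetSetoid x).symm hg)⟩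
  have hlt : ∀ x (i : ℕ), (i : ℕ∞) < 𝒮.index x ↔ ∃ n, x ∈ Q i n := fun x i => by
    rw [hindex, lt_card_subtype_iff_exists_count_eq]; rfl
  let N : ℕ → X → ℕ := fun i x => if h : ∃ n, x ∈ Q i n then h.choose else 0
  have hN : ∀ i x n, x ∈ Q i n → N i x = n := by
    intro i x n hx
    have h : ∃ n, x ∈ Q i n := ⟨n, hx⟩
    simp only [N, dif_pos h]
    exact Nat.count_injective h.choose_spec.1 hx.1 (h.choose_spec.2.trans hx.2.symm)
  have hNm : ∀ i, Measurable fun x => φ (N i x) x := by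
    intro i E hE
    have : (fun x => φ (N i x) x) ⁻¹' E =
        (⋃ n, Q i n ∩ φ n ⁻¹' E) ∪ ((⋃ n, Q i n)ᶜ ∩ φ 0 ⁻¹' E) := by
      ext x
      by_cases h : ∃ n, x ∈ Q i n
      · obtain ⟨n, hn⟩ := h
        have h1 : x ∈ ⋃ n, Q i n := mem_iUnion.2 ⟨n, hn⟩
        simp only [mem_preimage, mem_union, mem_iUnion, mem_inter_iff, mem_compl_iff, h1,
          not_true_eq_false, false_and, or_false, hN i x n hn]
        constructor
        · exact fun h => ⟨n, hn, h⟩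
        · rintro ⟨m, hm, h⟩
          rwa [← hN i x n hn, hN i x m hm]
      · have h0 : N i x = 0 := dif_neg h
        have h1 : x ∉ ⋃ n, Q i n := fun h' => h (mem_iUnion.1 h')
        simp only [mem_preimage, mem_union, mem_iUnion, mem_inter_iff, mem_compl_iff, h1,
          not_false_eq_true, true_and, h0]
        exact ⟨Or.inr, fun h' => h'.resolve_left fun ⟨n, hn, _⟩ => h ⟨n, hn⟩⟩
    rw [this]
    exact (MeasurableSet.iUnion fun n => (hQm i n).inter (hφm n hE)).union
      ((MeasurableSet.iUnion fun n => hQm i n).compl.inter (hφm 0 hE))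
  refine ⟨⟨⟨fun i x => φ (N i x) x, hNm, fun i x => hφr _ x, fun x g => ?_⟩⟩, fun i => ?_⟩
  · obtain ⟨n, hn, hg⟩ := hnew x g
    have hQ : x ∈ Q (Nat.count (p x) n) n := ⟨hn, rfl⟩
    refine ⟨Nat.count (p x) n, ⟨(hlt _ _).2 ⟨n, hQ⟩, ?_⟩, ?_⟩
    · have : (⟨φ (N (Nat.count (p x) n) x) x, hφr _ x⟩ : {g // 𝒢.r g = x}) = φ' n x :=
        Subtype.ext (by rw [hN _ x n hQ])
      rw [this]
      exact hg
    · rintro j ⟨hj, hgj⟩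
      obtain ⟨m, hm⟩ := (hlt x j).1 hj
      have : (⟨φ (N j x) x, hφr _ x⟩ : {g // 𝒢.r g = x}) = φ' m x :=
        Subtype.ext (by rw [hN _ x m hm])
      rw [this] at hgj
      have := hpinj x m n hm.1 hn ((𝒮.cosetSetoid x).trans ((𝒮.cosetSetoid x).symm hgj) hg)
      rw [← hm.2, this]
  · simp only [hlt, ofPred_exists]
    exact MeasurableSet.iUnion fun n => hQm i n

theorem BorelSubgroupoid.measurableSet_index_eq (h𝒢 : 𝒢.IsDiscretePMP μ)
    (𝒮 : BorelSubgroupoid 𝒢) (m : ℕ∞) : MeasurableSet {x | 𝒮.index x = m} := by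
  have : {x | 𝒮.index x = m} = ⋂ i : ℕ, {x | (i : ℕ∞) < 𝒮.index x ↔ (i : ℕ∞) < m} := by
    ext x
    simp only [mem_ofPred_eq, mem_iInter]
    refine ⟨fun h i => by rw [h], fun h => ?_⟩
    refine le_antisymm (le_of_not_gt fun hlt => ?_) (le_of_not_gt fun hlt => ?_)
    · obtain ⟨n, rfl⟩ := ENat.ne_top_iff_exists.1 hlt.ne_top
      exact lt_irrefl _ ((h n).1 hlt)
    · obtain ⟨n, hn⟩ := ENat.ne_top_iff_exists.1 hlt.ne_top
      rw [← hn] at hlt h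
      exact lt_irrefl _ ((h n).2 hlt)
  rw [this]
  refine MeasurableSet.iInter fun i => ?_
  by_cases hi : (i : ℕ∞) < m
  · simpa only [hi, iff_true] using (𝒮.exists_choiceFunctions h𝒢).2 i
  · simp only [hi, iff_false]
    exact ((𝒮.exists_choiceFunctions h𝒢).2 i).compl

end choice

/-! ### Central sequences and Borel sets of units -/

/-- To show that the measures of a sequence of sets tend to zero, one may work on each member of a
countable cover separately, because all but finitely many members are negligible. -/
theorem tendsto_measure_zero_of_cover {Ω : Type*} [MeasurableSpace Ω] (ρ : Measure Ω)
    [IsFiniteMeasure ρ] {Q E : ℕ → Set Ω} (hE : ∀ k, MeasurableSet (E k))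
    (hQE : ∀ n, Q n ⊆ ⋃ k, E k) (h : ∀ k, Tendsto (fun n => ρ (Q n ∩ E k)) atTop (𝓝 0)) :
    Tendsto (fun n => ρ (Q n)) atTop (𝓝 0) := by
  let R : ℕ → Set Ω := fun K => (⋃ k, E k) \ ⋃ k ∈ Finset.range K, E k
  have hRm : ∀ K, MeasurableSet (R K) := fun K =>
    (MeasurableSet.iUnion hE).diff (Finset.measurableSet_biUnion _ fun k _ => hE k)
  have hR : Tendsto (fun K => ρ (R K)) atTop (𝓝 0) := by
    have h0 : ⋂ K, R K = ∅ := by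
      rw [eq_empty_iff_forall_notMem]
      intro x hx
      rw [mem_iInter] at hx
      obtain ⟨k, hk⟩ := mem_iUnion.1 (hx 0).1
      exact (hx (k + 1)).2 (mem_biUnion (Finset.mem_coe.2 (Finset.self_mem_range_succ k)) hk)
    rw [← measure_empty (μ := ρ), ← h0]
    refine tendsto_measure_iInter_atTop (fun K => (hRm K).nullMeasurableSet) ?_
      ⟨0, measure_ne_top _ _⟩
    intro K L hKL
    exact sdiff_subset_sdiff_right (biUnion_subset_biUnion_left (Finset.range_mono hKL))
  rw [ENNReal.tendsto_nhds_zero]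
  intro ε hε
  obtain ⟨K, hK⟩ := (ENNReal.tendsto_nhds_zero.1 hR (ε / 2) (ENNReal.half_pos hε.ne')).exists
  have hsum : Tendsto (fun n => ∑ k ∈ Finset.range K, ρ (Q n ∩ E k)) atTop (𝓝 0) := by
    simpa using tendsto_finsetSum (Finset.range K) fun k _ => h k
  filter_upwards [ENNReal.tendsto_nhds_zero.1 hsum (ε / 2) (ENNReal.half_pos hε.ne')] with n hn
  have hsub : Q n ⊆ R K ∪ ⋃ k ∈ Finset.range K, Q n ∩ E k := by
    intro x hx
    by_cases hx' : x ∈ ⋃ k ∈ Finset.range K, E k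
    · obtain ⟨k, hk, hxk⟩ := mem_iUnion₂.1 hx'
      exact Or.inr (mem_biUnion (Finset.mem_coe.2 hk) ⟨hx, hxk⟩)
    · exact Or.inl ⟨hQE n hx, hx'⟩
  calc ρ (Q n) ≤ ρ (R K) + ρ (⋃ k ∈ Finset.range K, Q n ∩ E k) :=
        (measure_mono hsub).trans (measure_union_le _ _)
    _ ≤ ε / 2 + ε / 2 := add_le_add hK ((measure_biUnion_finset_le _ _).trans hn)
    _ = ε := ENNReal.add_halves ε

section central

variable {X G : Type*} [MeasurableSpace X] [MeasurableSpace G] {𝒢 : SetGroupoid X G} {μ : Measure X}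

/-- The set of units that are the source of at least three arrows. -/
def SetGroupoid.manyArrows {X G : Type*} (𝒢 : SetGroupoid X G) : Set X :=
  {x | ∃ g h, 𝒢.s g = x ∧ 𝒢.s h = x ∧ g ≠ 𝒢.unit x ∧ h ≠ 𝒢.unit x ∧ g ≠ h}

theorem SetGroupoid.s_mem_manyArrows_of_r {X G : Type*} {𝒢 : SetGroupoid X G} {k : G}
    (h : 𝒢.r k ∈ 𝒢.manyArrows) : 𝒢.s k ∈ 𝒢.manyArrows := by
  obtain ⟨a, b, ha, hb, ha1, hb1, hab⟩ := h
  -- right translation by `k` is a bijection of `s⁻¹(r k)` onto `s⁻¹(s k)`; it maps `{unit, a, b}`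
  -- to `{k, a k, b k}`, from which the unit has to be removed
  have hk : 𝒢.s (𝒢.unit (𝒢.r k)) = 𝒢.r k := 𝒢.s_unit _
  have hne : ∀ {a b : G}, 𝒢.s a = 𝒢.r k → 𝒢.s b = 𝒢.r k → a ≠ b → 𝒢.pmul a k ≠ 𝒢.pmul b k :=
    fun ha hb hab e => hab (pmul_right_cancel ha hb e)
  have h1 := hne ha hk ha1
  have h2 := hne hb hk hb1
  have h3 := hne ha hb hab
  rw [unit_pmul rfl] at h1 h2
  by_cases e1 : k = 𝒢.unit (𝒢.s k)
  · exact ⟨_, _, s_pmul ha, s_pmul hb, e1 ▸ h1, e1 ▸ h2, h3⟩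
  by_cases e2 : 𝒢.pmul a k = 𝒢.unit (𝒢.s k)
  · exact ⟨_, _, rfl, s_pmul hb, e1, e2 ▸ h3.symm, h2.symm⟩
  · exact ⟨_, _, rfl, s_pmul ha, e1, e2, h1.symm⟩

theorem SetGroupoid.r_mem_manyArrows_iff {X G : Type*} {𝒢 : SetGroupoid X G} {k : G} :
    𝒢.r k ∈ 𝒢.manyArrows ↔ 𝒢.s k ∈ 𝒢.manyArrows := by
  refine ⟨s_mem_manyArrows_of_r, fun h => ?_⟩
  rw [← 𝒢.s_inv]
  exact s_mem_manyArrows_of_r (by rwa [𝒢.r_inv])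

theorem SetGroupoid.IsDiscretePMP.measurableSet_manyArrows (h𝒢 : 𝒢.IsDiscretePMP μ) :
    MeasurableSet 𝒢.manyArrows := by
  have := h𝒢.standardBorel_arrows
  obtain ⟨τ, hτ⟩ := h𝒢.exists_fullGroup_cover
  have : 𝒢.manyArrows = ⋃ (k : ℕ) (l : ℕ), {x | (τ k).toFun x = 𝒢.unit x}ᶜ ∩
      ({x | (τ l).toFun x = 𝒢.unit x}ᶜ ∩ {x | (τ k).toFun x = (τ l).toFun x}ᶜ) := by
    ext x
    simp only [mem_iUnion]
    constructor
    · rintro ⟨g, h, hg, hh, hg1, hh1, hgh⟩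
      obtain ⟨k, hk⟩ := hτ g
      obtain ⟨l, hl⟩ := hτ h
      rw [hg] at hk
      rw [hh] at hl
      subst hk hl
      exact ⟨k, l, hg1, hh1, hgh⟩
    · rintro ⟨k, l, h1, h2, h3⟩
      exact ⟨_, _, (τ k).source x, (τ l).source x, h1, h2, h3⟩
  rw [this]
  refine MeasurableSet.iUnion fun k => MeasurableSet.iUnion fun l => ?_
  exact (measurableSet_eq_fun (τ k).measurable h𝒢.measurable_unit).compl.inter
    ((measurableSet_eq_fun (τ l).measurable h𝒢.measurable_unit).compl.inter
    (measurableSet_eq_fun (τ k).measurable (τ l).measurable).compl)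

/-- A central sequence commutes with an element of the full group that is supported exactly on
`s(D)`, hence preserves `s(D)` asymptotically. -/
theorem IsCentralSeq.tendsto_of_isotropy (h𝒢 : 𝒢.IsDiscretePMP μ) {T : ℕ → FullGroup 𝒢}
    (hT : IsCentralSeq μ T) {D : Set G} (hD : MeasurableSet D) (hs : InjOn 𝒢.s D)
    (hiso : ∀ g ∈ D, 𝒢.s g = 𝒢.r g) (hne : ∀ g ∈ D, g ≠ 𝒢.unit (𝒢.s g)) :
    Tendsto (fun n => μ {x | x ∈ 𝒢.s '' D ∧ (T n).circ x ∉ 𝒢.s '' D}) atTop (𝓝 0) := by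
  obtain ⟨S, hS, hS'⟩ := FullGroup.exists_of_bisection h𝒢 hD hs
    (fun g hg h hh e => hs hg hh (by rwa [hiso g hg, hiso h hh])) (image_congr hiso)
  refine tendsto_of_tendsto_of_tendsto_of_le_of_le tendsto_const_nhds (hT S) (fun _ => zero_le)
    fun n => measure_mono ?_
  rintro _ ⟨⟨g, hg, rfl⟩, hn⟩ e
  rw [FullGroup.comp_eq_pmul, FullGroup.comp_eq_pmul, hS' _ hn, FullGroup.circ, hS g hg,
    ← hiso g hg,
    SetGroupoid.unit_pmul (x := (T n).circ (𝒢.s g)) rfl] at e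
  refine hne g hg (SetGroupoid.pmul_left_cancel (𝒢 := 𝒢) (g := (T n).toFun (𝒢.s g)) ?_ ?_ ?_)
  · rw [(T n).source, hiso g hg]
  · rw [(T n).source, 𝒢.r_unit]
  · rw [e, SetGroupoid.pmul_unit ((T n).source _)]

/-- A central sequence commutes with a swap of `s(D)` and `r(D)`, hence preserves the union of these
two sets asymptotically. -/
theorem IsCentralSeq.tendsto_of_swap (h𝒢 : 𝒢.IsDiscretePMP μ) {T : ℕ → FullGroup 𝒢}
    (hT : IsCentralSeq μ T) {D : Set G} (hD : MeasurableSet D) (hs : InjOn 𝒢.s D)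
    (hr : InjOn 𝒢.r D) (hd : Disjoint (𝒢.s '' D) (𝒢.r '' D)) :
    Tendsto (fun n => μ {x | x ∈ 𝒢.s '' D ∧ (T n).circ x ∉ 𝒢.s '' D ∪ 𝒢.r '' D}) atTop
      (𝓝 0) := by
  obtain ⟨S, hS, hS'⟩ := FullGroup.exists_swap h𝒢 hD hs hr hd
  refine tendsto_of_tendsto_of_tendsto_of_le_of_le tendsto_const_nhds (hT S) (fun _ => zero_le)
    fun n => measure_mono ?_
  rintro _ ⟨⟨g, hg, rfl⟩, hn⟩ e
  have h1 := congrArg 𝒢.r e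
  rw [FullGroup.range_comp, FullGroup.comp_eq_pmul, hS' _ (fun h => hn (Or.inl h))
    (fun h => hn (Or.inr h)), SetGroupoid.unit_pmul (x := (T n).circ (𝒢.s g)) rfl] at h1
  have h2 : S.circ (𝒢.s g) = 𝒢.s g := (T n).injective h1
  rw [FullGroup.circ, hS g hg] at h2
  exact Set.disjoint_left.1 hd (mem_image_of_mem _ hg) (h2 ▸ mem_image_of_mem _ hg)

/-- A central sequence preserves asymptotically each Borel set of units in which at least three
arrows start. Off the isotropy, a point `x` of the set `B` and two further points of its orbit give
two swaps of pieces of `B` with disjoint sets, and what is preserved by both swaps is preserved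
within `B`. For units with only two arrows the statement fails, as the flip of the full equivalence
relation on two points shows. -/
theorem IsCentralSeq.tendsto_measure_circ_notMem (h𝒢 : 𝒢.IsDiscretePMP μ) {T : ℕ → FullGroup 𝒢}
    (hT : IsCentralSeq μ T) {B : Set X} (hB : MeasurableSet B) :
    Tendsto (fun n => μ {x | x ∈ 𝒢.manyArrows ∧ x ∈ B ∧ (T n).circ x ∉ B}) atTop (𝓝 0) := by
  have := h𝒢.standardBorel_units
  have := h𝒢.standardBorel_arrows
  have := h𝒢.isProbabilityMeasure
  obtain ⟨D, hDm, hDs, hDr, hD⟩ := h𝒢.exists_bisection_cover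
  obtain ⟨P, hPm, hP⟩ := exists_separating_seq X
  let I : ℕ → Set G := fun k =>
    D k ∩ (𝒢.s ⁻¹' B ∩ ({g | 𝒢.s g = 𝒢.r g} ∩ {g | g = 𝒢.unit (𝒢.s g)}ᶜ))
  have hIm : ∀ k, MeasurableSet (I k) := fun k => (hDm k).inter ((h𝒢.measurable_s hB).inter
    ((measurableSet_eq_fun h𝒢.measurable_s h𝒢.measurable_r).inter
      (measurableSet_eq_fun measurable_id (h𝒢.measurable_unit.comp h𝒢.measurable_s)).compl))
  let J : Set X → ℕ → ℕ → Set G := fun R k i =>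
    D k ∩ (𝒢.s ⁻¹' (B ∩ P i) ∩ 𝒢.r ⁻¹' ((P i)ᶜ ∩ R))
  have hJm : ∀ {R : Set X}, MeasurableSet R → ∀ k i, MeasurableSet (J R k i) := fun hR k i =>
    (hDm k).inter ((h𝒢.measurable_s (hB.inter (hPm i))).inter
      (h𝒢.measurable_r ((hPm i).compl.inter hR)))
  have hJs : ∀ R k i, InjOn 𝒢.s (J R k i) := fun R k i => (hDs k).mono inter_subset_left
  have hJr : ∀ R k i, InjOn 𝒢.r (J R k i) := fun R k i => (hDr k).mono inter_subset_left
  have hJd : ∀ R k i, Disjoint (𝒢.s '' J R k i) (𝒢.r '' J R k i) := by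
    intro R k i
    rw [Set.disjoint_left]
    rintro _ ⟨g, hg, rfl⟩ ⟨h, hh, e⟩
    exact hh.2.2.1 (e ▸ hg.2.1.2)
  have hsm : ∀ {A : Set G}, MeasurableSet A → InjOn 𝒢.s A → MeasurableSet (𝒢.s '' A) :=
    fun hA hi => hA.image_of_measurable_injOn h𝒢.measurable_s hi
  obtain ⟨e, he⟩ := exists_surjective_nat (ℕ ⊕ ℕ × ℕ × ℕ × ℕ × ℕ)
  -- the two swaps move a point of the second kind of piece to `P m` and to its complement
  let E : ℕ ⊕ ℕ × ℕ × ℕ × ℕ × ℕ → Set X := Sum.elim (fun k => 𝒢.s '' I k)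
    fun q => 𝒢.s '' J (P q.1) q.2.1 q.2.2.1 ∩ 𝒢.s '' J (P q.1)ᶜ q.2.2.2.1 q.2.2.2.2
  have hEm : ∀ q, MeasurableSet (E q) := by
    rintro (k | q)
    · exact hsm (hIm k) ((hDs k).mono inter_subset_left)
    · exact (hsm (hJm (hPm _) _ _) (hJs _ _ _)).inter (hsm (hJm (hPm _).compl _ _) (hJs _ _ _))
  refine tendsto_measure_zero_of_cover μ (E := fun k => E (e k)) (fun k => hEm _) ?_ ?_
  · rintro n x ⟨⟨g, h, hg, hh, hg1, hh1, hgh⟩, hxB, -⟩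
    have iso : ∀ a, 𝒢.s a = x → 𝒢.r a = x → a ≠ 𝒢.unit x → x ∈ ⋃ k, E (e k) := by
      intro a ha ha' hne
      obtain ⟨k, hk⟩ := hD a
      obtain ⟨m, hm⟩ := he (Sum.inl k)
      refine mem_iUnion.2 ⟨m, ?_⟩
      simp only [hm]
      refine ⟨a, ⟨hk, ?_, ha.trans ha'.symm, ?_⟩, ha⟩
      · rwa [mem_preimage, ha]
      · exact fun e' => hne (e'.trans (by rw [ha]))
    by_cases hgx : 𝒢.r g = x
    · exact iso g hg hgx hg1
    by_cases hhx : 𝒢.r h = x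
    · exact iso h hh hhx hh1
    -- two non-unit arrows with the same range differ by an isotropy arrow at `x`
    by_cases hrr : 𝒢.r g = 𝒢.r h
    · refine iso (𝒢.pmul (𝒢.inv g) h) ?_ ?_ fun e' => hgh ?_
      · rw [SetGroupoid.s_pmul (by rw [𝒢.s_inv, hrr]), hh]
      · rw [SetGroupoid.r_pmul (by rw [𝒢.s_inv, hrr]), 𝒢.r_inv, hg]
      · rw [← SetGroupoid.pmul_inv_pmul hrr, e', SetGroupoid.pmul_unit hg]
    obtain ⟨i, hi, hi'⟩ := hP x _ (Ne.symm hgx)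
    obtain ⟨j, hj, hj'⟩ := hP x _ (Ne.symm hhx)
    obtain ⟨m, hm, hm'⟩ := hP _ _ hrr
    obtain ⟨k, hk⟩ := hD g
    obtain ⟨l, hl⟩ := hD h
    obtain ⟨N, hN⟩ := he (Sum.inr (m, k, i, l, j))
    refine mem_iUnion.2 ⟨N, ?_⟩
    simp only [hN]
    refine ⟨⟨g, ⟨hk, ?_, hi', hm⟩, hg⟩, ⟨h, ⟨hl, ?_, hj', hm'⟩, hh⟩⟩
    · rw [mem_preimage, hg]; exact ⟨hxB, hi⟩
    · rw [mem_preimage, hh]; exact ⟨hxB, hj⟩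
  · intro k
    -- a point leaving `B` leaves each `s(J)`, so it is in both sets `r(J)`, which are disjoint
    rcases e k with k | q
    · refine tendsto_of_tendsto_of_tendsto_of_le_of_le tendsto_const_nhds
        (hT.tendsto_of_isotropy h𝒢 (hIm k) ((hDs k).mono inter_subset_left)
          (fun g hg => hg.2.2.1) (fun g hg => hg.2.2.2)) (fun _ => zero_le)
        fun n => measure_mono ?_
      rintro x ⟨⟨-, -, hn⟩, hx⟩
      refine ⟨hx, ?_⟩
      rintro ⟨g, hg, hgx⟩
      exact hn (hgx ▸ hg.2.1)
    · have h1 := hT.tendsto_of_swap h𝒢 (hJm (hPm q.1) q.2.1 q.2.2.1) (hJs _ _ _) (hJr _ _ _)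
        (hJd _ _ _)
      have h2 := hT.tendsto_of_swap h𝒢 (hJm (hPm q.1).compl q.2.2.2.1 q.2.2.2.2) (hJs _ _ _)
        (hJr _ _ _) (hJd _ _ _)
      have h12 := h1.add h2
      rw [add_zero] at h12
      refine tendsto_of_tendsto_of_tendsto_of_le_of_le tendsto_const_nhds h12 (fun _ => zero_le)
        fun n => (measure_mono ?_).trans (measure_union_le _ _)
      rintro x ⟨⟨-, -, hn⟩, hx1, hx2⟩
      by_contra hno
      rw [mem_union, not_or] at hno
      have m1 : (T n).circ x ∈ 𝒢.s '' _ ∪ 𝒢.r '' _ := by_contra fun h => hno.1 ⟨hx1, h⟩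
      have m2 : (T n).circ x ∈ 𝒢.s '' _ ∪ 𝒢.r '' _ := by_contra fun h => hno.2 ⟨hx2, h⟩
      rcases m1 with ⟨g, hg, hgx⟩ | ⟨g, hg, hgx⟩
      · exact hn (hgx ▸ hg.2.1.1)
      rcases m2 with ⟨h, hh, hhx⟩ | ⟨h, hh, hhx⟩
      · exact hn (hhx ▸ hh.2.1.1)
      · exact hh.2.2.2 (hhx ▸ hgx ▸ hg.2.2.2)

end central

/-! ### Coordinates on the co-induced space -/

section sequences

/-- Permuting the coordinates of an infinite power by an injection and moving each of them by a
measure-preserving map preserves the product measure. -/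
theorem map_infinitePi_eq_of_injective {Y ι : Type*} [MeasurableSpace Y] {ν : Measure Y}
    [IsProbabilityMeasure ν] {σ : ι → ι} (hσ : Function.Injective σ) {f : ι → Y → Y}
    (hf : ∀ i, MeasurePreserving (f i) ν ν) :
    (Measure.infinitePi fun _ : ι => ν).map (fun y i => f i (y (σ i))) =
      Measure.infinitePi fun _ : ι => ν := by
  refine Measure.eq_infinitePi _ fun s t ht => ?_
  have hm : Measurable fun (y : ι → Y) i => f i (y (σ i)) :=
    measurable_pi_lambda _ fun i => (hf i).measurable.comp (measurable_pi_apply _)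
  let t' : ι → Set Y := Function.extend σ (fun i => f i ⁻¹' t i) fun _ => univ
  have ht' : ∀ i, t' (σ i) = f i ⁻¹' t i := fun i => hσ.extend_apply _ _ i
  rw [Measure.map_apply hm (MeasurableSet.pi s.countable_toSet fun i _ => ht i)]
  have hpre : (fun (y : ι → Y) i => f i (y (σ i))) ⁻¹' (Set.pi s t) =
      Set.pi (s.map ⟨σ, hσ⟩ : Finset ι) t' := by
    ext y
    simp [Set.mem_pi, ht']
  rw [hpre, Measure.infinitePi_pi, Finset.prod_map]
  · refine Finset.prod_congr rfl fun i _ => ?_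
    simp only [Function.Embedding.coeFn_mk, ht']
    exact (hf i).measure_preimage (ht i).nullMeasurableSet
  · intro k hk
    obtain ⟨i, -, rfl⟩ := Finset.mem_map.1 hk
    simp only [Function.Embedding.coeFn_mk, ht']
    exact (hf i).measurable (ht i)

/-- For measure-preserving transformations `Φ n` of a finite measure space, the measurable sets `A`
with `ρ (A \ (Φ n)⁻¹ A) → 0` form a `σ`-algebra. -/
@[reducible]
def asymptoticallyInvariant {Ω : Type*} [m : MeasurableSpace Ω] (ρ : Measure Ω) [IsFiniteMeasure ρ]
    (Φ : ℕ → Ω → Ω) (hΦ : ∀ n, MeasurePreserving (Φ n) ρ ρ) : MeasurableSpace Ω where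
  MeasurableSet' A := MeasurableSet[m] A ∧
    Tendsto (fun n => ρ {ω | ω ∈ A ∧ Φ n ω ∉ A}) atTop (𝓝 0)
  measurableSet_empty := ⟨MeasurableSet.empty, by simp⟩
  measurableSet_compl A := by
    rintro ⟨hA, h⟩
    refine ⟨hA.compl, h.congr fun n => ?_⟩
    have e1 : {ω | ω ∈ A ∧ Φ n ω ∉ A} = A \ Φ n ⁻¹' A := rfl
    have e2 : {ω | ω ∈ Aᶜ ∧ Φ n ω ∉ Aᶜ} = Φ n ⁻¹' A \ A := by
      ext ω; simp [and_comm]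
    rw [e1, e2]
    exact measure_sdiff_symm hA.nullMeasurableSet ((hΦ n).measurable hA).nullMeasurableSet
      ((hΦ n).measure_preimage hA.nullMeasurableSet).symm (measure_ne_top _ _)
  measurableSet_iUnion A hA := by
    refine ⟨MeasurableSet.iUnion fun k => (hA k).1, ?_⟩
    refine tendsto_measure_zero_of_cover ρ (E := A) (fun k => (hA k).1) (fun n ω hω => hω.1)
      fun k => ?_
    refine tendsto_of_tendsto_of_tendsto_of_le_of_le tendsto_const_nhds (hA k).2 (fun _ => zero_le)
      fun n => measure_mono ?_
    rintro ω ⟨⟨-, hn⟩, hk⟩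
    exact ⟨hk, fun h => hn (mem_iUnion.2 ⟨k, h⟩)⟩

end sequences

section model

variable {X G : Type*} [MeasurableSpace G] {𝒢 : SetGroupoid X G} {𝒮 : BorelSubgroupoid 𝒢}
  {Y : Type*}

/-- The map from sequences to the product spaces that keeps the coordinates below the index. -/
noncomputable def BorelSubgroupoid.truncate (𝒮 : BorelSubgroupoid 𝒢) (Y : Type*)
    (ω : X × (ℕ → Y)) : CoindCode X Y :=
  ⟨𝒮.index ω.1, ω.1, fun i => ω.2 i⟩

open Classical in
/-- The map from the product spaces to sequences that fills up with the value `y₀`. -/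
noncomputable def CoindCode.fill (y₀ : Y) (c : CoindCode X Y) : X × (ℕ → Y) :=
  (c.2.1, fun i => if h : (i : ℕ∞) < c.1 then c.2.2 ⟨i, h⟩ else y₀)

open Classical in
/-- The operation on sequences that resets the coordinates from the index on to `y₀`. -/
noncomputable def BorelSubgroupoid.reset (𝒮 : BorelSubgroupoid 𝒢) (y₀ : Y) (ω : X × (ℕ → Y)) :
    X × (ℕ → Y) :=
  (ω.1, fun i => if (i : ℕ∞) < 𝒮.index ω.1 then ω.2 i else y₀)

theorem BorelSubgroupoid.reset_snd_of_lt (y₀ : Y) {ω : X × (ℕ → Y)} {i : ℕ}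
    (hi : (i : ℕ∞) < 𝒮.index ω.1) : (𝒮.reset y₀ ω).2 i = ω.2 i :=
  if_pos hi

theorem BorelSubgroupoid.reset_snd_of_not_lt (y₀ : Y) {ω : X × (ℕ → Y)} {i : ℕ}
    (hi : ¬ (i : ℕ∞) < 𝒮.index ω.1) : (𝒮.reset y₀ ω).2 i = y₀ :=
  if_neg hi

/-- The part of a set of the disjoint union `CoindCode X Y` in the component of index `m`. -/
def CoindCode.slice (A : Set (CoindCode X Y)) (m : ℕ∞) :
    Set (X × ({i : ℕ // (i : ℕ∞) < m} → Y)) :=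
  {p | (⟨m, p⟩ : CoindCode X Y) ∈ A}

theorem BorelSubgroupoid.truncate_preimage (𝒮 : BorelSubgroupoid 𝒢) (A : Set (CoindCode X Y)) :
    𝒮.truncate Y ⁻¹' A = ⋃ m : ℕ∞, ({x | 𝒮.index x = m} ×ˢ univ) ∩
      (Prod.map id fun (y : ℕ → Y) (i : {i : ℕ // (i : ℕ∞) < m}) => y i) ⁻¹'
        CoindCode.slice A m := by
  ext ω
  simp only [mem_iUnion]
  constructor
  · exact fun h => ⟨𝒮.index ω.1, ⟨rfl, mem_univ _⟩, h⟩
  · rintro ⟨m, ⟨rfl, -⟩, h⟩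
    exact h

variable [MeasurableSpace X] [MeasurableSpace Y] {ν : Measure Y}

theorem CoindCode.measurable_fill (y₀ : Y) :
    Measurable (CoindCode.fill y₀ : CoindCode X Y → X × (ℕ → Y)) := by
  intro A hA
  rw [MeasurableSpace.measurableSet_iInf]
  intro m
  have hm : Measurable fun p : X × ({i : ℕ // (i : ℕ∞) < m} → Y) =>
      (p.1, fun i : ℕ => if h : (i : ℕ∞) < m then p.2 ⟨i, h⟩ else y₀) := by
    refine measurable_fst.prodMk (measurable_pi_lambda _ fun i => ?_)
    by_cases h : (i : ℕ∞) < m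
    · simp only [h, dif_pos]
      exact (measurable_pi_apply _).comp measurable_snd
    · simp only [h, dif_neg, not_false_eq_true]
      exact measurable_const
  exact hm hA

theorem CoindCode.measurableSet_slice {A : Set (CoindCode X Y)} (hA : MeasurableSet A) (m : ℕ∞) :
    MeasurableSet (CoindCode.slice A m) :=
  (MeasurableSpace.measurableSet_iInf.1 hA) m

theorem BorelSubgroupoid.measurableSet_truncate_piece {μ : Measure X} (h𝒢 : 𝒢.IsDiscretePMP μ)
    (𝒮 : BorelSubgroupoid 𝒢) {A : Set (CoindCode X Y)} (hA : MeasurableSet A) (m : ℕ∞) :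
    MeasurableSet (({x | 𝒮.index x = m} ×ˢ univ) ∩
      (Prod.map id fun (y : ℕ → Y) (i : {i : ℕ // (i : ℕ∞) < m}) => y i) ⁻¹'
        CoindCode.slice A m) := by
  refine ((𝒮.measurableSet_index_eq h𝒢 m).prod MeasurableSet.univ).inter ?_
  exact (measurable_id.prodMap (measurable_pi_lambda _ fun i => measurable_pi_apply _))
    (CoindCode.measurableSet_slice hA m)

theorem BorelSubgroupoid.measurable_truncate {μ : Measure X} (h𝒢 : 𝒢.IsDiscretePMP μ)
    (𝒮 : BorelSubgroupoid 𝒢) : Measurable (𝒮.truncate Y) := by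
  intro A hA
  rw [truncate_preimage]
  exact MeasurableSet.iUnion fun m => 𝒮.measurableSet_truncate_piece h𝒢 hA m

/-- The measure on the product spaces is the image of `μ × ν^ℕ`. -/
theorem coindCodeMeasure_apply [IsProbabilityMeasure ν] {μ : Measure X} (h𝒢 : 𝒢.IsDiscretePMP μ)
    (𝒮 : BorelSubgroupoid 𝒢) {A : Set (CoindCode X Y)} (hA : MeasurableSet A) :
    coindCodeMeasure 𝒮 μ ν A =
      (μ.prod (Measure.infinitePi fun _ : ℕ => ν)) (𝒮.truncate Y ⁻¹' A) := by
  have := h𝒢.isProbabilityMeasure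
  rw [coindCodeMeasure, Measure.sum_apply _ hA, BorelSubgroupoid.truncate_preimage, measure_iUnion]
  · refine tsum_congr fun m => ?_
    have hmk : Measurable fun p : X × ({i : ℕ // (i : ℕ∞) < m} → Y) =>
        (⟨m, p⟩ : CoindCode X Y) := fun B hB => CoindCode.measurableSet_slice hB m
    have hAm := CoindCode.measurableSet_slice hA m
    have hres : MeasurePreserving (fun (y : ℕ → Y) (i : {i : ℕ // (i : ℕ∞) < m}) => y i)
        (Measure.infinitePi fun _ : ℕ => ν)
        (Measure.infinitePi fun _ : {i : ℕ // (i : ℕ∞) < m} => ν) :=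
      ⟨measurable_pi_lambda _ fun i => measurable_pi_apply _,
        Measure.infinitePi_map_restrict' (fun _ : ℕ => ν) (I := {i : ℕ | (i : ℕ∞) < m})⟩
    refine (Measure.map_apply hmk hA).trans ?_
    change ((μ.restrict {x | 𝒮.index x = m}).prod
      (Measure.infinitePi fun _ : {i : ℕ // (i : ℕ∞) < m} => ν)) (CoindCode.slice A m) = _
    rw [← ((MeasurePreserving.id (μ.restrict {x | 𝒮.index x = m})).prod hres).measure_preimage
        hAm.nullMeasurableSet]
    rw [← Measure.restrict_univ (μ := Measure.infinitePi fun _ : ℕ => ν), Measure.prod_restrict,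
      Measure.restrict_apply, Measure.restrict_univ, inter_comm]
    exact (measurable_id.prodMap hres.measurable) hAm
  · intro m m' hne
    refine Set.disjoint_left.2 ?_
    rintro ω ⟨⟨h, -⟩, -⟩ ⟨⟨h', -⟩, -⟩
    exact hne (h.symm.trans h')
  · exact fun m => 𝒮.measurableSet_truncate_piece h𝒢 hA m

variable {α : AutHom 𝒮 ν} {ψ : ChoiceFunctions 𝒮}

/-- The sequence `(f (ψ_i x))_i` of a point `f ∈ Z_x`, filled up with the value `y₀`. -/
noncomputable def CoindSpace.coords (y₀ : Y) (z : CoindSpace α ψ) : X × (ℕ → Y) :=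
  z.code.fill y₀

theorem CoindSpace.coords_snd (y₀ : Y) (z : CoindSpace α ψ) {i : ℕ}
    (hi : (i : ℕ∞) < 𝒮.index z.base) :
    (z.coords y₀).2 i = z.toFun ⟨ψ.ψ i z.base, ψ.range_eq i z.base⟩ :=
  dif_pos hi

theorem CoindSpace.coords_snd_of_not (y₀ : Y) (z : CoindSpace α ψ) {i : ℕ}
    (hi : ¬ (i : ℕ∞) < 𝒮.index z.base) : (z.coords y₀).2 i = y₀ :=
  dif_neg hi

theorem CoindSpace.measurable_coords (y₀ : Y) :
    Measurable (CoindSpace.coords y₀ : CoindSpace α ψ → X × (ℕ → Y)) :=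
  (CoindCode.measurable_fill y₀).comp (comap_measurable CoindSpace.code)

theorem CoindSpace.exists_eq_coords_preimage {μ : Measure X} (h𝒢 : 𝒢.IsDiscretePMP μ) (y₀ : Y)
    {E : Set (CoindSpace α ψ)} (hE : MeasurableSet E) :
    ∃ A : Set (X × (ℕ → Y)), MeasurableSet A ∧ E = CoindSpace.coords y₀ ⁻¹' A := by
  obtain ⟨A, hA, rfl⟩ := hE
  refine ⟨𝒮.truncate Y ⁻¹' A, 𝒮.measurable_truncate h𝒢 hA, ?_⟩
  have : ∀ z : CoindSpace α ψ, 𝒮.truncate Y (z.coords y₀) = z.code := by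
    intro z
    refine congrArg (Sigma.mk (𝒮.index z.base)) (Prod.ext rfl (funext fun i => ?_))
    exact z.coords_snd y₀ i.2
  ext z
  rw [mem_preimage, mem_preimage, mem_preimage, this]

/-- Upper bound for the measure on `Z` in terms of sequences. -/
theorem coindMeasure_coords_preimage_le [IsProbabilityMeasure ν] {μ : Measure X}
    (h𝒢 : 𝒢.IsDiscretePMP μ) (y₀ : Y) {A : Set (X × (ℕ → Y))} (hA : MeasurableSet A) :
    coindMeasure μ α ψ (CoindSpace.coords y₀ ⁻¹' A) ≤
      (μ.prod (Measure.infinitePi fun _ : ℕ => ν)) (𝒮.reset y₀ ⁻¹' A) := by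
  refine (Measure.comap_apply_le _ _
    (CoindSpace.measurable_coords y₀ hA).nullMeasurableSet).trans ?_
  refine (measure_mono (t := CoindCode.fill y₀ ⁻¹' A) ?_).trans
    (coindCodeMeasure_apply h𝒢 𝒮 (CoindCode.measurable_fill y₀ hA)).le
  rintro _ ⟨z, hz, rfl⟩
  exact hz

end model

/-! ### The lift of an element of the full group in coordinates -/

section transport

theorem measurable_apply_nat {Ω β : Type*} [MeasurableSpace Ω] [MeasurableSpace β] {N : Ω → ℕ}
    (hN : Measurable N) {F : ℕ → Ω → β} (hF : ∀ n, Measurable (F n)) :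
    Measurable fun ω => F (N ω) ω :=
  (measurable_from_prod_countable_left (f := fun p : Ω × ℕ => F p.2 p.1) hF).comp
    (measurable_id.prodMk hN)

variable {X G : Type*} [MeasurableSpace G] {𝒢 : SetGroupoid X G}
  {𝒮 : BorelSubgroupoid 𝒢} {Y : Type*} [MeasurableSpace Y] {ν : Measure Y}

open Classical in
/-- The action of a homomorphism `α` defined on a subgroupoid, extended by the identity to all
arrows. -/
noncomputable def AutHom.extend (α : AutHom 𝒮 ν) (g : G) (y : Y) : Y :=
  if h : g ∈ 𝒮.carrier then α.toFun ⟨g, h⟩ y else y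

theorem AutHom.measurable_extend (α : AutHom 𝒮 ν) :
    Measurable fun p : G × Y => α.extend p.1 p.2 := by
  classical
  refine Measurable.dite (s := (Prod.fst ⁻¹' 𝒮.carrier : Set (G × Y)))
    (f := fun p => α.toFun ⟨p.1.1, p.2⟩ p.1.2) ?_ (g := fun p => p.1.2)
    (measurable_snd.comp measurable_subtype_coe) (measurable_fst 𝒮.measurableSet)
  exact α.measurable.comp (((measurable_fst.comp measurable_subtype_coe).subtype_mk).prodMk
    (measurable_snd.comp measurable_subtype_coe))

theorem AutHom.measurePreserving_extend (α : AutHom 𝒮 ν) (g : G) :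
    MeasurePreserving (α.extend g) ν ν := by
  by_cases h : g ∈ 𝒮.carrier
  · rw [show α.extend g = α.toFun ⟨g, h⟩ from funext fun y => dif_pos h]
    exact α.measurePreserving _
  · rw [show α.extend g = id from funext fun y => dif_neg h]
    exact MeasurePreserving.id ν

theorem AutHom.measure_extend_notMem_le (α : AutHom 𝒮 ν) (h : 𝒮.carrier) (C : Set Y) :
    ν {y | y ∈ C ∧ α.extend h y ∉ C} ≤ ν (symmDiff (α.toFun h '' C) C) := by
  have : {y | y ∈ C ∧ α.extend h y ∉ C} = α.toFun h ⁻¹' (α.toFun h '' C \ C) := by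
    ext y
    have hy : α.extend h y = α.toFun h y := dif_pos h.2
    simp [hy]
  rw [this, (α.measurePreserving h).measure_preimage_equiv]
  exact measure_mono fun y hy => Or.inl hy

variable [MeasurableSpace X]

/-- The index `i` of the class of `g` among the choice functions. -/
noncomputable def ChoiceFunctions.position (ψ : ChoiceFunctions 𝒮) {x : X}
    (g : {g // 𝒢.r g = x}) : ℕ :=
  (ψ.complete x g).choose

theorem ChoiceFunctions.position_lt (ψ : ChoiceFunctions 𝒮) {x : X} (g : {g // 𝒢.r g = x}) :
    (ψ.position g : ℕ∞) < 𝒮.index x :=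
  (ψ.complete x g).choose_spec.1.1

theorem ChoiceFunctions.equiv_position (ψ : ChoiceFunctions 𝒮) {x : X} (g : {g // 𝒢.r g = x}) :
    𝒮.cosetSetoid x g ⟨ψ.ψ (ψ.position g) x, ψ.range_eq _ x⟩ :=
  (ψ.complete x g).choose_spec.1.2

theorem ChoiceFunctions.position_eq_iff (ψ : ChoiceFunctions 𝒮) {x : X} (g : {g // 𝒢.r g = x})
    (j : ℕ) : ψ.position g = j ↔
      (j : ℕ∞) < 𝒮.index x ∧ 𝒢.pmul (𝒢.inv g) (ψ.ψ j x) ∈ 𝒮.carrier := by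
  rw [← 𝒮.cosetSetoid_iff g ⟨ψ.ψ j x, ψ.range_eq j x⟩]
  constructor
  · rintro rfl
    exact ⟨ψ.position_lt g, ψ.equiv_position g⟩
  · exact fun h => ((ψ.complete x g).choose_spec.2 j h).symm

/-- The choice function `ψ_i` over `T° x`, pulled back to `x` by the arrow `T x`. -/
noncomputable def FullGroup.pull (T : FullGroup 𝒢) (ψ : ChoiceFunctions 𝒮) (x : X) (i : ℕ) :
    {g // 𝒢.r g = x} :=
  ⟨𝒢.pmul (𝒢.inv (T.toFun x)) (ψ.ψ i (T.circ x)), by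
    rw [SetGroupoid.r_pmul (by rw [𝒢.s_inv, ψ.range_eq, circ]), 𝒢.r_inv, T.source]⟩

open Classical in
/-- The injection of the index set that describes how the arrow `T x` moves the equivalence
classes; it is the identity from the index at `x` on. -/
noncomputable def FullGroup.perm (T : FullGroup 𝒢) (ψ : ChoiceFunctions 𝒮) (x : X) (i : ℕ) : ℕ :=
  if (i : ℕ∞) < 𝒮.index x then ψ.position (T.pull ψ x i) else i

/-- The arrow `h` of `𝒮` with `(T x)⁻¹ ψ_i(T° x) = ψ_j(x) h⁻¹`, where `j = T.perm ψ x i`. -/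
noncomputable def FullGroup.cocycle (T : FullGroup 𝒢) (ψ : ChoiceFunctions 𝒮) (x : X) (i : ℕ) :
    G :=
  𝒢.pmul (𝒢.inv (T.pull ψ x i)) (ψ.ψ (T.perm ψ x i) x)

open Classical in
/-- The action of the lift of `T` on `Z`, written in the coordinates given by the choice
functions and extended to all sequences by fixing the coordinates from the index on. -/
noncomputable def FullGroup.transport (T : FullGroup 𝒢) (α : AutHom 𝒮 ν) (ψ : ChoiceFunctions 𝒮)
    (ω : X × (ℕ → Y)) : X × (ℕ → Y) :=
  (T.circ ω.1, fun i => (if (i : ℕ∞) < 𝒮.index ω.1 then α.extend (T.cocycle ψ ω.1 i) else id)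
    (ω.2 (T.perm ψ ω.1 i)))

theorem FullGroup.index_circ (T : FullGroup 𝒢) (𝒮 : BorelSubgroupoid 𝒢) (x : X) :
    𝒮.index (T.circ x) = 𝒮.index x := by
  rw [circ, 𝒮.index_r, T.source]

theorem FullGroup.perm_of_lt (T : FullGroup 𝒢) (ψ : ChoiceFunctions 𝒮) {x : X} {i : ℕ}
    (hi : (i : ℕ∞) < 𝒮.index x) : T.perm ψ x i = ψ.position (T.pull ψ x i) :=
  if_pos hi

theorem FullGroup.perm_of_not_lt (T : FullGroup 𝒢) (ψ : ChoiceFunctions 𝒮) {x : X} {i : ℕ}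
    (hi : ¬ (i : ℕ∞) < 𝒮.index x) : T.perm ψ x i = i :=
  if_neg hi

theorem FullGroup.perm_lt (T : FullGroup 𝒢) (ψ : ChoiceFunctions 𝒮) {x : X} {i : ℕ}
    (hi : (i : ℕ∞) < 𝒮.index x) : (T.perm ψ x i : ℕ∞) < 𝒮.index x := by
  rw [T.perm_of_lt ψ hi]
  exact ψ.position_lt _

theorem FullGroup.perm_injective (T : FullGroup 𝒢) (ψ : ChoiceFunctions 𝒮) (x : X) :
    Function.Injective (T.perm ψ x) := by
  intro i j e
  by_cases hi : (i : ℕ∞) < 𝒮.index x <;> by_cases hj : (j : ℕ∞) < 𝒮.index x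
  · rw [T.perm_of_lt ψ hi, T.perm_of_lt ψ hj] at e
    have h := (𝒮.cosetSetoid x).trans (e ▸ ψ.equiv_position (T.pull ψ x i))
      ((𝒮.cosetSetoid x).symm (ψ.equiv_position (T.pull ψ x j)))
    have h := (𝒮.cosetSetoid_iff _ _).1 h
    simp only [pull] at h
    rw [SetGroupoid.inv_pmul_pmul_pmul (by rw [𝒢.s_inv, ψ.range_eq, circ])
      (by rw [ψ.range_eq, ψ.range_eq])] at h
    have hp := fun k => ψ.position_eq_iff ⟨ψ.ψ i (T.circ x), ψ.range_eq i (T.circ x)⟩ k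
    rw [T.index_circ 𝒮 x] at hp
    refine ((hp i).2 ⟨hi, ?_⟩).symm.trans ((hp j).2 ⟨hj, h⟩)
    rw [SetGroupoid.inv_pmul_self]
    exact 𝒮.unit_mem _
  · have h := T.perm_lt ψ hi
    rw [e, T.perm_of_not_lt ψ hj] at h
    exact absurd h hj
  · have h := T.perm_lt ψ hj
    rw [← e, T.perm_of_not_lt ψ hi] at h
    exact absurd h hi
  · rwa [T.perm_of_not_lt ψ hi, T.perm_of_not_lt ψ hj] at e

variable {μ : Measure X}

theorem FullGroup.measurable_pull (h𝒢 : 𝒢.IsDiscretePMP μ) (T : FullGroup 𝒢)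
    (ψ : ChoiceFunctions 𝒮) (i : ℕ) : Measurable fun x => (T.pull ψ x i : G) :=
  h𝒢.measurable_pmul.comp ((h𝒢.measurable_inv.comp T.measurable).prodMk
    ((ψ.measurable i).comp (T.measurable_circ h𝒢)))

theorem BorelSubgroupoid.measurableSet_lt_index (h𝒢 : 𝒢.IsDiscretePMP μ) (𝒮 : BorelSubgroupoid 𝒢)
    (i : ℕ) : MeasurableSet {x | (i : ℕ∞) < 𝒮.index x} :=
  (𝒮.exists_choiceFunctions h𝒢).2 i

theorem FullGroup.measurable_perm (h𝒢 : 𝒢.IsDiscretePMP μ) (T : FullGroup 𝒢)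
    (ψ : ChoiceFunctions 𝒮) (i : ℕ) : Measurable fun x => T.perm ψ x i := by
  classical
  refine Measurable.ite (𝒮.measurableSet_lt_index h𝒢 i) (measurable_to_nat fun x₀ => ?_)
    measurable_const
  have : (fun x => ψ.position (T.pull ψ x i)) ⁻¹' {ψ.position (T.pull ψ x₀ i)} =
      {x | ((ψ.position (T.pull ψ x₀ i) : ℕ) : ℕ∞) < 𝒮.index x} ∩
        (fun x => 𝒢.pmul (𝒢.inv (T.pull ψ x i)) (ψ.ψ (ψ.position (T.pull ψ x₀ i)) x)) ⁻¹'
          𝒮.carrier := by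
    ext x
    exact ψ.position_eq_iff _ _
  rw [this]
  exact (𝒮.measurableSet_lt_index h𝒢 _).inter (h𝒢.measurable_pmul.comp
    ((h𝒢.measurable_inv.comp (T.measurable_pull h𝒢 ψ i)).prodMk (ψ.measurable _)) 𝒮.measurableSet)

theorem FullGroup.measurable_cocycle (h𝒢 : 𝒢.IsDiscretePMP μ) (T : FullGroup 𝒢)
    (ψ : ChoiceFunctions 𝒮) (i : ℕ) : Measurable fun x => T.cocycle ψ x i :=
  h𝒢.measurable_pmul.comp ((h𝒢.measurable_inv.comp (T.measurable_pull h𝒢 ψ i)).prodMk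
    (measurable_apply_nat (T.measurable_perm h𝒢 ψ i) ψ.measurable))

theorem FullGroup.measurePreserving_transport [IsProbabilityMeasure ν] (h𝒢 : 𝒢.IsDiscretePMP μ)
    (T : FullGroup 𝒢) (α : AutHom 𝒮 ν) (ψ : ChoiceFunctions 𝒮) {μ' : Measure X} [SFinite μ']
    (hT : MeasurePreserving T.circ μ' μ') :
    MeasurePreserving (T.transport α ψ) (μ'.prod (Measure.infinitePi fun _ : ℕ => ν))
      (μ'.prod (Measure.infinitePi fun _ : ℕ => ν)) := by
  classical
  refine hT.skew_product (g := fun x (y : ℕ → Y) (i : ℕ) =>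
    (if (i : ℕ∞) < 𝒮.index x then α.extend (T.cocycle ψ x i) else id) (y (T.perm ψ x i))) ?_
    (ae_of_all _ fun x => ?_)
  · refine measurable_pi_lambda _ fun i => ?_
    have h1 : Measurable fun p : X × (ℕ → Y) => p.2 (T.perm ψ p.1 i) :=
      measurable_apply_nat (F := fun n (p : X × (ℕ → Y)) => p.2 n)
        ((T.measurable_perm h𝒢 ψ i).comp measurable_fst)
        fun n => (measurable_pi_apply n).comp measurable_snd
    have h2 : Measurable fun p : X × (ℕ → Y) => if (i : ℕ∞) < 𝒮.index p.1 then
        α.extend (T.cocycle ψ p.1 i) (p.2 (T.perm ψ p.1 i)) else p.2 (T.perm ψ p.1 i) :=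
      Measurable.ite (measurable_fst (𝒮.measurableSet_lt_index h𝒢 i))
        (α.measurable_extend.comp (((T.measurable_cocycle h𝒢 ψ i).comp measurable_fst).prodMk h1))
        h1
    convert h2 using 1
    ext p
    simp only [Function.uncurry]
    split_ifs <;> rfl
  · refine map_infinitePi_eq_of_injective (T.perm_injective ψ x) fun i => ?_
    split_ifs
    · exact α.measurePreserving_extend _
    · exact MeasurePreserving.id ν

variable {α : AutHom 𝒮 ν} {ψ : ChoiceFunctions 𝒮}

theorem FullGroup.transport_snd_of_lt (T : FullGroup 𝒢) {ω : X × (ℕ → Y)} {i : ℕ}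
    (hi : (i : ℕ∞) < 𝒮.index ω.1) : (T.transport α ψ ω).2 i =
      α.extend (T.cocycle ψ ω.1 i) (ω.2 (T.perm ψ ω.1 i)) :=
  congrFun (if_pos hi) _

theorem FullGroup.transport_snd_of_not_lt (T : FullGroup 𝒢) {ω : X × (ℕ → Y)} {i : ℕ}
    (hi : ¬ (i : ℕ∞) < 𝒮.index ω.1) : (T.transport α ψ ω).2 i = ω.2 i :=
  (congrFun (if_neg hi) _).trans (congrArg ω.2 (T.perm_of_not_lt ψ hi))

theorem FullGroup.reset_transport_reset (T : FullGroup 𝒢) (y₀ : Y) (ω : X × (ℕ → Y)) :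
    𝒮.reset y₀ (T.transport α ψ (𝒮.reset y₀ ω)) = 𝒮.reset y₀ (T.transport α ψ ω) := by
  refine Prod.ext rfl (funext fun i => ?_)
  have hc : ∀ ω : X × (ℕ → Y), (T.transport α ψ ω).1 = T.circ ω.1 := fun _ => rfl
  have hb : (𝒮.reset y₀ ω).1 = ω.1 := rfl
  by_cases hi : (i : ℕ∞) < 𝒮.index ω.1
  · rw [BorelSubgroupoid.reset_snd_of_lt y₀ (by rwa [hc, T.index_circ, hb]),
      BorelSubgroupoid.reset_snd_of_lt y₀ (by rwa [hc, T.index_circ]),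
      T.transport_snd_of_lt (by rwa [hb]), T.transport_snd_of_lt hi, hb,
      BorelSubgroupoid.reset_snd_of_lt y₀ (T.perm_lt ψ hi)]
  · rw [BorelSubgroupoid.reset_snd_of_not_lt y₀ (by rwa [hc, T.index_circ, hb]),
      BorelSubgroupoid.reset_snd_of_not_lt y₀ (by rwa [hc, T.index_circ])]

/-- In coordinates, the lift of `T` acts on `Z` by `T.transport`. -/
theorem CoindSpace.coords_act (T : FullGroup 𝒢) (y₀ : Y) (z : CoindSpace α ψ) :
    (z.act (T.toFun z.base) (T.source z.base)).coords y₀ =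
      𝒮.reset y₀ (T.transport α ψ (z.coords y₀)) := by
  refine Prod.ext rfl (funext fun i => ?_)
  have hb : (z.act (T.toFun z.base) (T.source z.base)).base = T.circ z.base := rfl
  have hb' : (z.coords y₀).1 = z.base := rfl
  have hc : (T.transport α ψ (z.coords y₀)).1 = T.circ z.base := rfl
  by_cases hi : (i : ℕ∞) < 𝒮.index z.base
  · rw [coords_snd y₀ _ (by rwa [hb, T.index_circ 𝒮])]
    rw [BorelSubgroupoid.reset_snd_of_lt y₀ (by rwa [hc, T.index_circ]),
      T.transport_snd_of_lt (by rwa [hb']), hb']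
    rw [coords_snd y₀ z (T.perm_lt ψ hi)]
    have hmem : T.cocycle ψ z.base i ∈ 𝒮.carrier := by
      rw [FullGroup.cocycle, T.perm_of_lt ψ hi]
      exact ((ψ.position_eq_iff (T.pull ψ z.base i) _).1 rfl).2
    have hr : 𝒢.r (T.pull ψ z.base i) = 𝒢.r (ψ.ψ (T.perm ψ z.base i) z.base) := by
      rw [ψ.range_eq]; exact (T.pull ψ z.base i).2
    have hs : 𝒢.s (T.cocycle ψ z.base i) = 𝒢.s (ψ.ψ (T.perm ψ z.base i) z.base) :=
      SetGroupoid.s_pmul (by rw [𝒢.s_inv, hr])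
    rw [show α.extend (T.cocycle ψ z.base i) = α.toFun ⟨_, hmem⟩ from funext fun y => dif_pos hmem]
    have := z.equivariant ⟨ψ.ψ (T.perm ψ z.base i) z.base, ψ.range_eq _ _⟩ ⟨_, hmem⟩ hs
    rw [← this]
    have hpull : 𝒢.pmul (ψ.ψ (T.perm ψ z.base i) z.base) (𝒢.inv (T.cocycle ψ z.base i)) =
        T.pull ψ z.base i := by
      rw [FullGroup.cocycle, SetGroupoid.inv_pmul (by rw [𝒢.s_inv, hr]), 𝒢.inv_inv,
        SetGroupoid.pmul_inv_pmul hr.symm]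
    exact z.toFun_congr ((SetGroupoid.mul_eq_pmul _).trans
      (hpull.symm.trans (SetGroupoid.mul_eq_pmul _).symm)) _ _
  · rw [coords_snd_of_not y₀ _ (by rwa [hb, T.index_circ 𝒮])]
    rw [BorelSubgroupoid.reset_snd_of_not_lt y₀ (by rwa [hc, T.index_circ])]

end transport

/-! ### Asymptotic invariance of measurable sets -/

section convergence

variable {X G : Type*} [MeasurableSpace X] [MeasurableSpace G] {𝒢 : SetGroupoid X G} {μ : Measure X}
  {𝒮 : BorelSubgroupoid 𝒢} {Y : Type*} [MeasurableSpace Y] {ν : Measure Y}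

theorem FullGroup.measurePreserving_circ_restrict (h𝒢 : 𝒢.IsDiscretePMP μ) (T : FullGroup 𝒢) :
    MeasurePreserving T.circ (μ.restrict 𝒢.manyArrows) (μ.restrict 𝒢.manyArrows) := by
  have h := (T.measurePreserving_circ h𝒢).restrict_preimage h𝒢.measurableSet_manyArrows
  have : T.circ ⁻¹' 𝒢.manyArrows = 𝒢.manyArrows := by
    ext x
    rw [mem_preimage, circ, SetGroupoid.r_mem_manyArrows_iff, T.source]
  rwa [this] at h

/-- If the central sequence commutes with `R` at `x`, and `R` inverts `ψ_i` at `x` and at `T° x`,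
then `T` fixes the class of `ψ_i`, and the cocycle is a value of `T`. -/
theorem FullGroup.cocycle_eq_of_comm (T R : FullGroup 𝒢) (hT : ∀ x, T.toFun x ∈ 𝒮.carrier)
    (ψ : ChoiceFunctions 𝒮) {x : X} {i : ℕ} (hi : (i : ℕ∞) < 𝒮.index x)
    (hx : R.toFun x = 𝒢.inv (ψ.ψ i x)) (hTx : R.toFun (T.circ x) = 𝒢.inv (ψ.ψ i (T.circ x)))
    (hc : T.comp R x = R.comp T x) :
    T.perm ψ x i = i ∧ T.cocycle ψ x i = T.toFun (R.circ x) := by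
  rw [comp_eq_pmul, comp_eq_pmul, hTx] at hc
  have h1 : 𝒢.pmul (𝒢.inv (T.pull ψ x i)) (ψ.ψ i x) = T.toFun (R.circ x) := by
    rw [pull, SetGroupoid.inv_pmul (by rw [𝒢.s_inv, ψ.range_eq, circ]), 𝒢.inv_inv, ← hc, hx,
      SetGroupoid.pmul_assoc, SetGroupoid.inv_pmul_self, SetGroupoid.pmul_unit]
    · rw [T.source, circ, hx, 𝒢.r_inv]
    · rw [T.source, circ, hx]
    · rw [𝒢.s_inv]
  have h2 : T.perm ψ x i = i := by
    rw [T.perm_of_lt ψ hi, ψ.position_eq_iff]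
    exact ⟨hi, h1 ▸ hT _⟩
  exact ⟨h2, by rw [cocycle, h2, h1]⟩

variable [IsProbabilityMeasure ν]

/-- A central sequence in the full group of `𝒮` that is asymptotically trivial under `α` leaves each
coordinate of the co-induced action asymptotically invariant. On the piece where an element `R` of
the full group of `𝒢` inverts `ψ_i`, commuting with `R` makes `T` fix the class of `ψ_i` and act on
the `i`-th coordinate by `α (T (R° x))`, and `R°` preserves `μ`. -/
theorem IsCentralSeq.tendsto_coordinate (h𝒢 : 𝒢.IsDiscretePMP μ) (α : AutHom 𝒮 ν)
    (ψ : ChoiceFunctions 𝒮) {T : ℕ → FullGroup 𝒢} (hT : IsCentralSeq μ T)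
    (hT𝒮 : ∀ n x, (T n).toFun x ∈ 𝒮.carrier)
    (hTα : ∀ B : Set Y, MeasurableSet B →
      Tendsto (fun n => ∫⁻ x, ν (symmDiff (α.toFun ⟨(T n).toFun x, hT𝒮 n x⟩ '' B) B) ∂μ)
        atTop (𝓝 0)) {C : Set Y} (hC : MeasurableSet C) (i : ℕ) :
    Tendsto (fun n => ((μ.restrict 𝒢.manyArrows).prod (Measure.infinitePi fun _ : ℕ => ν))
      {ω | ω.2 i ∈ C ∧ ((T n).transport α ψ ω).2 i ∉ C}) atTop (𝓝 0) := by
  have := h𝒢.isProbabilityMeasure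
  have := h𝒢.standardBorel_arrows
  set π := Measure.infinitePi fun _ : ℕ => ν
  obtain ⟨τ, hτ⟩ := h𝒢.exists_fullGroup_cover
  let F : ℕ → Set X := fun k => {x | (τ k).toFun x = 𝒢.inv (ψ.ψ i x)}
  have hF : ∀ k, MeasurableSet (F k) := fun k =>
    measurableSet_eq_fun (τ k).measurable (h𝒢.measurable_inv.comp (ψ.measurable i))
  refine tendsto_measure_zero_of_cover _ (E := fun k => F k ×ˢ univ)
    (fun k => (hF k).prod MeasurableSet.univ) (fun n ω _ => ?_) fun k => ?_
  · obtain ⟨k, hk⟩ := hτ (𝒢.inv (ψ.ψ i ω.1))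
    rw [𝒢.s_inv, ψ.range_eq] at hk
    exact mem_iUnion.2 ⟨k, hk, mem_univ _⟩
  have fst_le : ∀ A : Set X, ((μ.restrict 𝒢.manyArrows).prod π) (A ×ˢ univ) =
      μ.restrict 𝒢.manyArrows A := fun A => by
    rw [Measure.prod_prod, measure_univ, mul_one]
  have h1 : Tendsto (fun n => ((μ.restrict 𝒢.manyArrows).prod π)
      ({x | x ∈ F k ∧ (T n).circ x ∉ F k} ×ˢ univ)) atTop (𝓝 0) := by
    refine (hT.tendsto_measure_circ_notMem h𝒢 (hF k)).congr fun n => ?_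
    rw [fst_le, Measure.restrict_apply' h𝒢.measurableSet_manyArrows, inter_comm]
    rfl
  have h2 : Tendsto (fun n => ((μ.restrict 𝒢.manyArrows).prod π)
      ({x | (T n).comp (τ k) x ≠ (τ k).comp (T n) x} ×ˢ univ)) atTop (𝓝 0) := by
    refine tendsto_of_tendsto_of_tendsto_of_le_of_le tendsto_const_nhds (hT (τ k)) (fun _ => zero_le)
      fun n => ?_
    rw [fst_le]
    exact Measure.restrict_apply_le _ _
  have h3 : Tendsto (fun n => ((μ.restrict 𝒢.manyArrows).prod π)
      {ω | ω.2 i ∈ C ∧ α.extend ((T n).toFun ((τ k).circ ω.1)) (ω.2 i) ∉ C}) atTop (𝓝 0) := by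
    refine tendsto_of_tendsto_of_tendsto_of_le_of_le tendsto_const_nhds (hTα C hC)
      (fun _ => zero_le) fun n => ?_
    let A : Set (X × Y) := {p | p.2 ∈ C ∧ α.extend ((T n).toFun p.1) p.2 ∉ C}
    have hA : MeasurableSet A := (measurable_snd hC).inter
      ((α.measurable_extend.comp (((T n).measurable.comp measurable_fst).prodMk measurable_snd))
        hC.compl)
    have hmp := ((τ k).measurePreserving_circ_restrict h𝒢).prod
      (measurePreserving_eval_infinitePi (fun _ : ℕ => ν) i)
    calc ((μ.restrict 𝒢.manyArrows).prod π)
          {ω | ω.2 i ∈ C ∧ α.extend ((T n).toFun ((τ k).circ ω.1)) (ω.2 i) ∉ C}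
        = ((μ.restrict 𝒢.manyArrows).prod ν) A := hmp.measure_preimage hA.nullMeasurableSet
      _ = ∫⁻ x in 𝒢.manyArrows, ν (Prod.mk x ⁻¹' A) ∂μ := Measure.prod_apply hA
      _ ≤ ∫⁻ x, ν (Prod.mk x ⁻¹' A) ∂μ := setLIntegral_le_lintegral _ _
      _ ≤ _ := lintegral_mono fun x => α.measure_extend_notMem_le ⟨(T n).toFun x, hT𝒮 n x⟩ C
  have h123 := (h1.add h2).add h3
  rw [add_zero, add_zero] at h123
  refine tendsto_of_tendsto_of_tendsto_of_le_of_le tendsto_const_nhds h123 (fun _ => zero_le)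
    fun n => (measure_mono ?_).trans ((measure_union_le _ _).trans
      (add_le_add_left (measure_union_le _ _) _))
  rintro ω ⟨⟨hC1, hC2⟩, hk, -⟩
  by_cases hi : (i : ℕ∞) < 𝒮.index ω.1
  · by_cases ha : (T n).circ ω.1 ∈ F k
    · by_cases hb : (T n).comp (τ k) ω.1 = (τ k).comp (T n) ω.1
      · obtain ⟨e1, e2⟩ := (T n).cocycle_eq_of_comm (τ k) (hT𝒮 n) ψ hi hk ha hb
        rw [(T n).transport_snd_of_lt hi, e1, e2] at hC2
        exact Or.inr ⟨hC1, hC2⟩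
      · exact Or.inl (Or.inr ⟨hb, mem_univ _⟩)
    · exact Or.inl (Or.inl ⟨⟨hk, ha⟩, mem_univ _⟩)
  · rw [(T n).transport_snd_of_not_lt hi] at hC2
    exact absurd hC1 hC2

/-- Under the hypotheses of `IsCentralSeq.tendsto_coordinate`, every measurable set of sequences
over the units with at least three arrows is asymptotically invariant. -/
theorem IsCentralSeq.tendsto_transport (h𝒢 : 𝒢.IsDiscretePMP μ) (α : AutHom 𝒮 ν)
    (ψ : ChoiceFunctions 𝒮) {T : ℕ → FullGroup 𝒢} (hT : IsCentralSeq μ T)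
    (hT𝒮 : ∀ n x, (T n).toFun x ∈ 𝒮.carrier)
    (hTα : ∀ B : Set Y, MeasurableSet B →
      Tendsto (fun n => ∫⁻ x, ν (symmDiff (α.toFun ⟨(T n).toFun x, hT𝒮 n x⟩ '' B) B) ∂μ)
        atTop (𝓝 0)) {A : Set (X × (ℕ → Y))} (hA : MeasurableSet A) :
    Tendsto (fun n => ((μ.restrict 𝒢.manyArrows).prod (Measure.infinitePi fun _ : ℕ => ν))
      {ω | ω ∈ A ∧ (T n).transport α ψ ω ∉ A}) atTop (𝓝 0) := by
  have := h𝒢.isProbabilityMeasure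
  have hΦ := fun n => (T n).measurePreserving_transport h𝒢 α ψ
    ((T n).measurePreserving_circ_restrict h𝒢)
  let m := asymptoticallyInvariant _ _ hΦ
  have h1 : Measurable[m] (Prod.fst : X × (ℕ → Y) → X) := by
    intro B hB
    refine ⟨measurable_fst hB, (hT.tendsto_measure_circ_notMem h𝒢 hB).congr fun n => ?_⟩
    rw [show {ω : X × (ℕ → Y) | ω ∈ Prod.fst ⁻¹' B ∧ (T n).transport α ψ ω ∉ Prod.fst ⁻¹' B} =
      {x | x ∈ B ∧ (T n).circ x ∉ B} ×ˢ univ by ext ω; simp [FullGroup.transport],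
      Measure.prod_prod, measure_univ, mul_one,
      Measure.restrict_apply' h𝒢.measurableSet_manyArrows, inter_comm]
    rfl
  have h2 : Measurable[m] (Prod.snd : X × (ℕ → Y) → ℕ → Y) := by
    refine @measurable_pi_lambda _ _ _ m _ _ fun i => ?_
    intro C hC
    exact ⟨((measurable_pi_apply i).comp measurable_snd) hC,
      hT.tendsto_coordinate h𝒢 α ψ hT𝒮 hTα hC i⟩
  have h3 : @Measurable _ _ m Prod.instMeasurableSpace fun ω : X × (ℕ → Y) => (ω.1, ω.2) :=
    h1.prodMk h2
  exact (h3 hA).2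

/-- The lifts of the central sequence leave each measurable subset of `Z` asymptotically invariant,
over the units with at least three arrows. -/
theorem IsCentralSeq.tendsto_lift_circ (h𝒢 : 𝒢.IsDiscretePMP μ) (α : AutHom 𝒮 ν)
    (ψ : ChoiceFunctions 𝒮) {T : ℕ → FullGroup 𝒢} (hT : IsCentralSeq μ T)
    (hT𝒮 : ∀ n x, (T n).toFun x ∈ 𝒮.carrier)
    (hTα : ∀ B : Set Y, MeasurableSet B →
      Tendsto (fun n => ∫⁻ x, ν (symmDiff (α.toFun ⟨(T n).toFun x, hT𝒮 n x⟩ '' B) B) ∂μ)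
        atTop (𝓝 0)) {E : Set (CoindSpace α ψ)} (hE : MeasurableSet E) :
    Tendsto (fun n => coindMeasure μ α ψ
      {z | z.base ∈ 𝒢.manyArrows ∧ z ∈ E ∧ ((T n).lift α ψ).circ z ∉ E}) atTop (𝓝 0) := by
  have := h𝒢.isProbabilityMeasure
  obtain ⟨y₀⟩ : Nonempty Y := nonempty_of_isProbabilityMeasure ν
  obtain ⟨A, hA, rfl⟩ := CoindSpace.exists_eq_coords_preimage h𝒢 y₀ hE
  have hreset : Measurable (𝒮.reset y₀ : X × (ℕ → Y) → X × (ℕ → Y)) :=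
    (CoindCode.measurable_fill y₀).comp (𝒮.measurable_truncate h𝒢)
  have hA' := hreset hA
  refine tendsto_of_tendsto_of_tendsto_of_le_of_le tendsto_const_nhds
    (hT.tendsto_transport h𝒢 α ψ hT𝒮 hTα hA') (fun _ => zero_le) fun n => ?_
  have hΦ := ((T n).measurePreserving_transport h𝒢 α ψ
    ((T n).measurePreserving_circ h𝒢)).measurable
  have hW : MeasurableSet (𝒢.manyArrows ×ˢ (univ : Set (ℕ → Y))) :=
    h𝒢.measurableSet_manyArrows.prod MeasurableSet.univ
  let B : Set (X × (ℕ → Y)) := 𝒢.manyArrows ×ˢ univ ∩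
    (A ∩ (fun ω => 𝒮.reset y₀ ((T n).transport α ψ ω)) ⁻¹' Aᶜ)
  have hB : MeasurableSet B := hW.inter (hA.inter ((hreset.comp hΦ) hA.compl))
  have hsub : {z : CoindSpace α ψ | z.base ∈ 𝒢.manyArrows ∧ z ∈ CoindSpace.coords y₀ ⁻¹' A ∧
      ((T n).lift α ψ).circ z ∉ CoindSpace.coords y₀ ⁻¹' A} ⊆ CoindSpace.coords y₀ ⁻¹' B := by
    rintro z ⟨hzW, hzA, hz⟩
    refine ⟨⟨hzW, mem_univ _⟩, hzA, ?_⟩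
    rw [mem_preimage, ← CoindSpace.coords_act]
    exact hz
  refine (measure_mono hsub).trans ((coindMeasure_coords_preimage_le h𝒢 y₀ hB).trans ?_)
  have hBW : 𝒮.reset y₀ ⁻¹' B = {ω | ω ∈ 𝒮.reset y₀ ⁻¹' A ∧
      (T n).transport α ψ ω ∉ 𝒮.reset y₀ ⁻¹' A} ∩ 𝒢.manyArrows ×ˢ univ := by
    ext ω
    have e : 𝒮.reset y₀ ω ∈ 𝒢.manyArrows ×ˢ (univ : Set (ℕ → Y)) ↔ ω ∈ 𝒢.manyArrows ×ˢ univ :=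
      Iff.rfl
    simp only [B, mem_preimage, mem_inter_iff, e, FullGroup.reset_transport_reset, mem_compl_iff,
      mem_ofPred_eq]
    tauto
  rw [hBW, ← Measure.restrict_univ (μ := Measure.infinitePi fun _ : ℕ => ν), Measure.prod_restrict,
    Measure.restrict_apply' hW, Measure.restrict_univ]

end convergence

/-! ### Commutation of the lifts with the full group -/

section lifts

variable {X G : Type*} [MeasurableSpace X] [MeasurableSpace G] {𝒢 : SetGroupoid X G} {μ : Measure X}
  {𝒮 : BorelSubgroupoid 𝒢} {Y : Type*} [MeasurableSpace Y] {ν : Measure Y}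

theorem FullGroup.measurable_comp (h𝒢 : 𝒢.IsDiscretePMP μ) (S T : FullGroup 𝒢) :
    Measurable (S.comp T) := by
  rw [show S.comp T = fun x => 𝒢.pmul (S.toFun (T.circ x)) (T.toFun x) from
    funext fun x => S.comp_eq_pmul T x]
  exact h𝒢.measurable_pmul.comp ((S.measurable.comp (T.measurable_circ h𝒢)).prodMk T.measurable)

theorem coindMeasure_base_preimage_le [IsProbabilityMeasure ν] (h𝒢 : 𝒢.IsDiscretePMP μ)
    (α : AutHom 𝒮 ν) (ψ : ChoiceFunctions 𝒮) {B : Set X} (hB : MeasurableSet B) :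
    coindMeasure μ α ψ (CoindSpace.base ⁻¹' B) ≤ μ B := by
  have := h𝒢.isProbabilityMeasure
  obtain ⟨y₀⟩ : Nonempty Y := nonempty_of_isProbabilityMeasure ν
  have h := coindMeasure_coords_preimage_le (α := α) (ψ := ψ) h𝒢 y₀
    (hB.prod (MeasurableSet.univ (α := ℕ → Y)))
  have e : 𝒮.reset y₀ ⁻¹' (B ×ˢ (univ : Set (ℕ → Y))) = B ×ˢ univ := rfl
  rw [e, Measure.prod_prod, measure_univ, mul_one] at h
  refine (measure_mono ?_).trans h
  exact fun z hz => ⟨hz, mem_univ _⟩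

theorem isFiniteMeasure_coindMeasure [IsProbabilityMeasure ν] (h𝒢 : 𝒢.IsDiscretePMP μ)
    (α : AutHom 𝒮 ν) (ψ : ChoiceFunctions 𝒮) : IsFiniteMeasure (coindMeasure μ α ψ) := by
  have := h𝒢.isProbabilityMeasure
  exact ⟨(coindMeasure_base_preimage_le h𝒢 α ψ MeasurableSet.univ).trans_lt (measure_lt_top μ _)⟩

/-- Over units in which at most two arrows start, the whole full group of the groupoid of the
co-induced action is commutative. -/
theorem FullGroup.comp_comm_of_base_notMem {α : AutHom 𝒮 ν} {ψ : ChoiceFunctions 𝒮}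
    (S T : FullGroup (coindGroupoid α ψ)) {z : CoindSpace α ψ} (hz : z.base ∉ 𝒢.manyArrows) :
    T.comp S z = S.comp T z := by
  refine S.comp_comm_of_source_le_two T ?_
  rintro ⟨⟨g, w⟩, hg⟩ ⟨⟨h, w'⟩, hh⟩ rfl (rfl : w' = w) hg1 hh1
  have hne : ∀ {k : G} (hk : 𝒢.s k = w'.base),
      (⟨(k, w'), hk⟩ : {p : G × CoindSpace α ψ // 𝒢.s p.1 = p.2.base}) ≠
        (coindGroupoid α ψ).unit w' → k ≠ 𝒢.unit w'.base := by
    rintro k hk hk1 rfl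
    exact hk1 rfl
  by_contra hgh
  refine hz ⟨g, h, hg, hh, hne hg hg1, hne hh hh1, ?_⟩
  rintro rfl
  exact hgh rfl

theorem FullGroup.lift_comp_comm {α : AutHom 𝒮 ν} {ψ : ChoiceFunctions 𝒮}
    (S : FullGroup (coindGroupoid α ψ)) (T R : FullGroup 𝒢) {z : CoindSpace α ψ}
    (hz : (S.toFun z).1.1 = R.toFun z.base)
    (hTz : (S.toFun ((T.lift α ψ).circ z)).1.1 = R.toFun (T.circ z.base))
    (hc : T.comp R z.base = R.comp T z.base) :
    (T.lift α ψ).comp S z = S.comp (T.lift α ψ) z := by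
  refine Subtype.ext (Prod.ext ?_ (S.source z))
  have hb : ((coindGroupoid α ψ).r (S.toFun z)).base = 𝒢.r (R.toFun z.base) := by
    rw [← hz]; rfl
  calc ((T.lift α ψ).comp S z).1.1 = T.comp R z.base :=
        𝒢.mul_congr (congrArg T.toFun hb) hz _ _
    _ = R.comp T z.base := hc
    _ = (S.comp (T.lift α ψ) z).1.1 := 𝒢.mul_congr hTz.symm rfl _ _

end lifts

theorem proposition2p2 {X G Y : Type*} [MeasurableSpace X] [MeasurableSpace G] [MeasurableSpace Y]
    [StandardBorelSpace Y] (𝒢 : SetGroupoid X G) (μ : Measure X) (h𝒢 : 𝒢.IsDiscretePMP μ)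
    (𝒮 : BorelSubgroupoid 𝒢) (ν : Measure Y) [IsProbabilityMeasure ν] (α : AutHom 𝒮 ν)
    (T : ℕ → FullGroup 𝒢) (hT : IsCentralSeq μ T)
    (hT𝒮 : ∀ n x, (T n).toFun x ∈ 𝒮.carrier)
    (hTα : ∀ B : Set Y, MeasurableSet B →
      Tendsto (fun n => ∫⁻ x, ν (symmDiff (α.toFun ⟨(T n).toFun x, hT𝒮 n x⟩ '' B) B) ∂μ)
        atTop (𝓝 0)) :
    Nonempty (ChoiceFunctions 𝒮) ∧
      ∀ ψ : ChoiceFunctions 𝒮,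
        IsCentralSeq (coindMeasure μ α ψ) fun n => (T n).lift α ψ := by
  refine ⟨(𝒮.exists_choiceFunctions h𝒢).1, fun ψ S => ?_⟩
  have := h𝒢.standardBorel_arrows
  have := isFiniteMeasure_coindMeasure h𝒢 α ψ
  obtain ⟨τ, hτ⟩ := h𝒢.exists_fullGroup_cover
  -- the arrow of `𝒢` in `S z = (g, z)` is a value of one of countably many `τ k`
  let E : ℕ → Set (CoindSpace α ψ) := fun k => {z | (S.toFun z).1.1 = (τ k).toFun z.base}
  have hE : ∀ k, MeasurableSet (E k) := fun k => measurableSet_eq_fun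
    (measurable_fst.comp (measurable_subtype_coe.comp S.measurable))
    ((τ k).measurable.comp CoindSpace.measurable_base)
  refine tendsto_measure_zero_of_cover _ hE (fun n z _ => ?_) fun k => ?_
  · obtain ⟨k, hk⟩ := hτ (S.toFun z).1.1
    rw [(S.toFun z).2, show (S.toFun z).1.2 = z from S.source z] at hk
    exact mem_iUnion.2 ⟨k, hk.symm⟩
  have h1 := hT.tendsto_lift_circ h𝒢 α ψ hT𝒮 hTα (hE k)
  have h2 : Tendsto (fun n => coindMeasure μ α ψ
      (CoindSpace.base ⁻¹' {x | (T n).comp (τ k) x ≠ (τ k).comp (T n) x})) atTop (𝓝 0) :=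
    tendsto_of_tendsto_of_tendsto_of_le_of_le tendsto_const_nhds (hT (τ k)) (fun _ => zero_le)
      fun n => coindMeasure_base_preimage_le h𝒢 α ψ
        (measurableSet_eq_fun ((T n).measurable_comp h𝒢 (τ k))
          ((τ k).measurable_comp h𝒢 (T n))).compl
  have h12 := h1.add h2
  rw [add_zero] at h12
  refine tendsto_of_tendsto_of_tendsto_of_le_of_le tendsto_const_nhds h12 (fun _ => zero_le)
    fun n => (measure_mono ?_).trans (measure_union_le _ _)
  rintro z ⟨hz, hzk⟩
  by_cases hW : z.base ∈ 𝒢.manyArrows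
  · by_cases ha : ((T n).lift α ψ).circ z ∈ E k
    · refine Or.inr fun hc => hz ?_
      exact S.lift_comp_comm (T n) (τ k) hzk ha hc
    · exact Or.inl ⟨hW, hzk, ha⟩
  · exact absurd (S.comp_comm_of_base_notMem ((T n).lift α ψ) hW) hz
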